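/- **Definitions.** An *($n$-dimensional, unoriented) resolution configuration* $C$ is a finite set of pairwise disjoint smoothly embedded circles in $S^2$ together with $n\ge 0$ pairwise disjoint smoothly embedded (unoriented) arcs whose endpoints lie on the circles and whose interiors are disjoint from the circles. The circles of $C$ are its *starting circles* $x_1,\dots,x_t$. The *dual configuration* $C^*$ has as circles the *ending circles* $y_1,\dots,y_s$, obtained from the starting circles by surgery along all the arcs, and as arcs the arcs of $C$ rotated by $90$ degrees; $m(C^*)$ is its image under a reflection of $S^2$. $C$ is *connected* if it has at least one circle and its circles cannot be partitioned into two non-empty sets such that no arc joins a circle of one set to a circle of the other. A *tree* is a connected $n$-dimensional configuration with exactly $n+1$ starting circles and exactly one ending circle; a *dual tree* is the dual of a tree. Put $V_0(C)=\bigotimes_{i=1}^t\mathbb F_2[x_i]/(x_i^2)$ and $V_1(C)=\bigotimes_{j=1}^s\mathbb F_2[y_j]/(y_j^2)$. A monomial of $V_0(C)$ or $V_1(C)$ is a product of distinct circles; its quantum degree $gr_q$ is the number of circles not dividing it minus the number of circles dividing it. A linear map $F_C:V_0(C)\to V_1(C)$, which has homological degree $n$ by convention, has *bidegree $(n,p)$*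 if $gr_q(b)+n-gr_q(a)=p$ for all monomials $a\in V_0(C)$, $b\in V_1(C)$ such that the coefficient of $F_C(a)$ at $b$ is non-zero. Let $F=(F_C)$ be a family of linear maps $F_C:V_0(C)\to V_1(C)$, one for every $n$-dimensional unoriented resolution configuration $C$. The rules are: * *Filtration rule:* if a point lies on the starting circle $x$ and on the ending circle $y$ of $C$, if the monomial $a$ is divisible by $x$, and if the coefficient of $F_C(a)$ at the monomial $b$ is non-zero, then $b$ is divisible by $y$. * *Duality rule:* for all monomials $a\in V_0(C)$, $b\in V_1(C)$, the coefficient of $F_C(a)$ at $b$ equals the coefficient of $F_{m(C^*)}(b^*)$ at $a^*$, where $^*$ exchanges $1$ and the variable in every tensor factor, and where $V_0(m(C^*))=V_1(C)$ and $V_1(m(C^*))=V_0(C)$ canonically. * *Naturality rule:* if an orientation-preserving diffeomorphism of $S^2$ sends $C$ to $C'$, then $F_C=F_{C'}$ under the induced identifications $V_0(C)=V_0(C')$ and $V_1(C)=V_1(C')$. **Theorem 3.4.** Let $n\ge 0$ and let $F$ be a family as above that satisfies the filtration, duality and naturality rules. Let $C$ be a connected $n$-dimensional unoriented resolution configuration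 that is neither a tree nor a dual tree. If $F_C$ has bidegree $(n,p)$ for some integer $p\ge 2n$, then $F_C=0$. -/

import Mathlib

open Set Module
open scoped Manifold ContDiff TensorProduct

noncomputable section

/-! ### The sphere, its orientation-preserving diffeomorphisms and its mirror reflection -/

/-- Euclidean three-space. -/
abbrev E3 : Type := EuclideanSpace ℝ (Fin 3)

/-- The sphere `S²`, as the unit sphere of `ℝ³`. -/
abbrev S2 : Type := Metric.sphere (0 : E3) 1

/-- The determinant of three vectors of `ℝ³`. -/
def tripleDet (u v w : E3) : ℝ := Matrix.det !![u 0, u 1, u 2; v 0, v 1, v 2; w 0, w 1, w 2]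

/-- A diffeomorphism `φ` of `S²` preserves the orientation: `S²` is oriented by declaring a pair
of tangent vectors `(u, v)` at `p` positive when `det (p, u, v) > 0`, and the differential of `φ`
sends positive pairs at `p` to positive pairs at `φ p`. (Tangent vectors are read in `ℝ³` through
the differential of the inclusion.) -/
def OrientationPreserving (φ : Diffeomorph (𝓡 2) (𝓡 2) S2 S2 ∞) : Prop :=
  ∀ (p : S2) (u v : TangentSpace (𝓡 2) p),
    0 < tripleDet (p : E3)
        (mfderiv (𝓡 2) 𝓘(ℝ, E3) (fun q : S2 => (q : E3)) p u)
        (mfderiv (𝓡 2) 𝓘(ℝ, E3) (fun q : S2 => (q : E3)) p v) →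
    0 < tripleDet (φ p : E3)
        (mfderiv (𝓡 2) 𝓘(ℝ, E3) (fun q : S2 => (φ q : E3)) p u)
        (mfderiv (𝓡 2) 𝓘(ℝ, E3) (fun q : S2 => (φ q : E3)) p v)

/-- The reflection `(x, y, z) ↦ (x, -y, z)` of `ℝ³`. Under stereographic projection from the north
pole it induces on `S² = ℝ² ∪ {∞}` the reflection along the line `ℝ × {0}`. -/
def reflect3 : E3 ≃ₗᵢ[ℝ] E3 :=
  (Submodule.span ℝ {(EuclideanSpace.single 1 1 : E3)})ᗮ.reflection

/-- The mirror reflection of `S²`. -/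
def mirrorPt (p : S2) : S2 :=
  ⟨reflect3 p, by simp⟩

theorem mirrorPt_mirrorPt (p : S2) : mirrorPt (mirrorPt p) = p :=
  Subtype.ext (Submodule.reflection_reflection _ _)

theorem mirrorPt_injective : Function.Injective mirrorPt :=
  Function.LeftInverse.injective mirrorPt_mirrorPt

theorem continuous_mirrorPt : Continuous mirrorPt :=
  (reflect3.continuous.comp continuous_subtype_val).subtype_mk _

/-! ### Embedded circles and arcs -/

/-- `s` is a smoothly embedded circle in `S²`. -/
def IsEmbeddedCircle (s : Set S2) : Prop :=
  ∃ c : ℝ → S2, ContDiff ℝ ∞ (fun t => (c t : E3)) ∧ Function.Periodic c 1 ∧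
    InjOn c (Ico 0 1) ∧ (∀ t, deriv (fun t => (c t : E3)) t ≠ 0) ∧ range c = s

/-- The restriction of `g` to `[0, 1]` is a smoothly embedded arc in `S²`. -/
def IsEmbeddedArc (g : ℝ → S2) : Prop :=
  ContDiff ℝ ∞ (fun t => (g t : E3)) ∧ InjOn g (Icc 0 1) ∧
    ∀ t ∈ Icc (0 : ℝ) 1, deriv (fun t => (g t : E3)) t ≠ 0

theorem deriv_mirror {g : ℝ → S2} (hg : ContDiff ℝ ∞ (fun t => (g t : E3))) (t : ℝ) :
    deriv (fun t => (mirrorPt (g t) : E3)) t = reflect3 (deriv (fun t => (g t : E3)) t) := by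
  have h : HasDerivAt (fun t => (g t : E3)) (deriv (fun t => (g t : E3)) t) t :=
    (hg.differentiable (by simp) t).hasDerivAt
  exact (reflect3.toContinuousLinearEquiv.toContinuousLinearMap.hasFDerivAt.comp_hasDerivAt t
    h).deriv

theorem contDiff_mirror {g : ℝ → S2} (hg : ContDiff ℝ ∞ (fun t => (g t : E3))) :
    ContDiff ℝ ∞ (fun t => (mirrorPt (g t) : E3)) :=
  reflect3.contDiff.comp hg

theorem IsEmbeddedCircle.mirror {s : Set S2} (h : IsEmbeddedCircle s) :
    IsEmbeddedCircle (mirrorPt '' s) := by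
  obtain ⟨c, h1, h2, h3, h4, h5⟩ := h
  refine ⟨fun t => mirrorPt (c t), contDiff_mirror h1, fun t => by simp only [h2 t],
    fun a ha b hb hab => h3 ha hb (mirrorPt_injective hab), fun t => ?_, ?_⟩
  · rw [deriv_mirror h1]
    simpa using h4 t
  · rw [← h5, ← range_comp]
    rfl

theorem IsEmbeddedArc.mirror {g : ℝ → S2} (h : IsEmbeddedArc g) :
    IsEmbeddedArc (fun t => mirrorPt (g t)) := by
  obtain ⟨h1, h2, h3⟩ := h
  refine ⟨contDiff_mirror h1, fun a ha b hb hab => h2 ha hb (mirrorPt_injective hab),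
    fun t ht => ?_⟩
  rw [deriv_mirror h1]
  simpa using h3 t ht

/-! ### Resolution configurations -/

/-- An (unoriented) `n`-dimensional resolution configuration: a finite set of disjoint smoothly
embedded circles in `S²` and a set of `n` disjoint smoothly embedded arcs, whose endpoints lie on
the circles and whose interiors are disjoint from the circles. -/
structure ResolutionConfiguration (n : ℕ) where
  circles : Finset (Set S2)
  isEmbeddedCircle : ∀ x ∈ circles, IsEmbeddedCircle x
  circles_disjoint : (circles : Set (Set S2)).Pairwise Disjoint
  arcs : Finset (Set S2)
  card_arcs : arcs.card = n
  isArc : ∀ γ ∈ arcs, ∃ g : ℝ → S2, IsEmbeddedArc g ∧ g '' Icc 0 1 = γ ∧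
    g 0 ∈ (⋃ x ∈ circles, x) ∧ g 1 ∈ (⋃ x ∈ circles, x) ∧
    Disjoint (g '' Ioo 0 1) (⋃ x ∈ circles, x)
  arcs_disjoint : (arcs : Set (Set S2)).Pairwise Disjoint

namespace ResolutionConfiguration

variable {n : ℕ}

/-- The union of the circles. -/
def circleUnion (C : ResolutionConfiguration n) : Set S2 := ⋃ x ∈ C.circles, x

/-- The union of the arcs. -/
def arcUnion (C : ResolutionConfiguration n) : Set S2 := ⋃ γ ∈ C.arcs, γ

/-- A configuration is connected if it is non-empty and its circles cannot be partitioned into two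
non-empty sets such that no arc connects a circle of the first set to a circle of the second. -/
def Connected (C : ResolutionConfiguration n) : Prop :=
  C.circles.Nonempty ∧
    ∀ S : Set (Set S2), (∃ x ∈ C.circles, x ∈ S) → (∃ x ∈ C.circles, x ∉ S) →
      ∃ γ ∈ C.arcs, ∃ x ∈ C.circles, ∃ x' ∈ C.circles,
        x ∈ S ∧ x' ∉ S ∧ (γ ∩ x).Nonempty ∧ (γ ∩ x').Nonempty

/-- The action of the mirror reflection on subsets of the sphere. -/
def mirrorSet : Set S2 ↪ Set S2 := ⟨fun s => mirrorPt '' s, mirrorPt_injective.image_injective⟩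

theorem iUnion_mirror (T : Finset (Set S2)) :
    (⋃ x ∈ T.map mirrorSet, x) = mirrorPt '' (⋃ x ∈ T, x) := by
  ext p
  simp only [mirrorSet, Finset.mem_map, Function.Embedding.coeFn_mk, mem_iUnion, mem_image]
  constructor
  · rintro ⟨_, ⟨x, hx, rfl⟩, q, hq, rfl⟩
    exact ⟨q, ⟨x, hx, hq⟩, rfl⟩
  · rintro ⟨q, ⟨x, hx, hq⟩, rfl⟩
    exact ⟨_, ⟨x, hx, rfl⟩, q, hq, rfl⟩

theorem pairwise_mirror {T : Finset (Set S2)} (h : (T : Set (Set S2)).Pairwise Disjoint) :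
    ((T.map mirrorSet : Finset (Set S2)) : Set (Set S2)).Pairwise Disjoint := by
  intro a ha b hb hab
  simp only [Finset.coe_map, mem_image] at ha hb
  obtain ⟨x, hx, rfl⟩ := ha
  obtain ⟨y, hy, rfl⟩ := hb
  exact (disjoint_image_iff mirrorPt_injective).2 (h hx hy fun e => hab (by rw [e]))

/-- The mirror image `m(C)` of a configuration. -/
def mirror (C : ResolutionConfiguration n) : ResolutionConfiguration n where
  circles := C.circles.map mirrorSet
  isEmbeddedCircle := by
    intro x hx
    obtain ⟨y, hy, rfl⟩ := Finset.mem_map.1 hx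
    exact (C.isEmbeddedCircle y hy).mirror
  circles_disjoint := pairwise_mirror C.circles_disjoint
  arcs := C.arcs.map mirrorSet
  card_arcs := by rw [Finset.card_map, C.card_arcs]
  isArc := by
    intro γ hγ
    obtain ⟨δ, hδ, rfl⟩ := Finset.mem_map.1 hγ
    obtain ⟨g, h1, h2, h3, h4, h5⟩ := C.isArc δ hδ
    refine ⟨fun t => mirrorPt (g t), h1.mirror, ?_, ?_, ?_, ?_⟩
    · rw [← h2]
      exact image_comp mirrorPt g _
    · rw [iUnion_mirror]
      exact mem_image_of_mem _ h3
    · rw [iUnion_mirror]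
      exact mem_image_of_mem _ h4
    · rw [iUnion_mirror, show (fun t => mirrorPt (g t)) '' Ioo 0 1 = mirrorPt '' (g '' Ioo 0 1) from
        image_comp mirrorPt g _]
      exact (disjoint_image_iff mirrorPt_injective).2 h5
  arcs_disjoint := pairwise_mirror C.arcs_disjoint

theorem circleUnion_mirror (C : ResolutionConfiguration n) :
    C.mirror.circleUnion = mirrorPt '' C.circleUnion := iUnion_mirror C.circles

/-- The canonical bijection between the circles of `C` and those of its mirror image. -/
def mirrorCircle (C : ResolutionConfiguration n) (x : C.circles) : C.mirror.circles :=
  ⟨mirrorPt '' (x : Set S2), Finset.mem_map.2 ⟨x, x.2, rfl⟩⟩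

end ResolutionConfiguration

/-! ### Surgery and duals -/

/-- The closed square `[-1, 1] × [-1, 1]`. -/
def square : Set (ℝ × ℝ) := Icc (-1) 1 ×ˢ Icc (-1) 1

/-- The vertical sides of the square. -/
def verticalSides : Set (ℝ × ℝ) := {-1, 1} ×ˢ Icc (-1) 1

/-- The horizontal sides of the square. -/
def horizontalSides : Set (ℝ × ℝ) := Icc (-1) 1 ×ˢ {-1, 1}

/-- The horizontal segment through the centre of the square. -/
def horizontalCore : Set (ℝ × ℝ) := Icc (-1) 1 ×ˢ {0}

/-- The vertical segment through the centre of the square: the horizontal one rotated by 90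
degrees. -/
def verticalCore : Set (ℝ × ℝ) := {0} ×ˢ Icc (-1) 1

/-- `D` represents the dual configuration `C*`: around the arcs of `C` there are disjoint embedded
closed bands in `S²`, each meeting the circles of `C` exactly in its two vertical sides and having
an arc of `C` as its horizontal core. The circles of `D` arise from those of `C` by surgery along
the arcs, i.e. by replacing the vertical sides of the bands by the horizontal ones; the arcs of `D`
are the arcs of `C` rotated by 90 degrees, i.e. the vertical cores of the bands. -/
def IsDualPair {n : ℕ} (C D : ResolutionConfiguration n) : Prop :=
  ∃ β : Fin n → ℝ × ℝ → S2,
    (∀ i, ContinuousOn (β i) square ∧ InjOn (β i) square) ∧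
    (Pairwise fun i j => Disjoint (β i '' square) (β j '' square)) ∧
    (∀ i, β i '' square ∩ C.circleUnion = β i '' verticalSides) ∧
    (∀ i, β i '' square ∩ D.circleUnion = β i '' horizontalSides) ∧
    (C.arcs : Set (Set S2)) = range (fun i => β i '' horizontalCore) ∧
    (D.arcs : Set (Set S2)) = range (fun i => β i '' verticalCore) ∧
    C.circleUnion \ (⋃ i, β i '' square) = D.circleUnion \ (⋃ i, β i '' square)

theorem IsDualPair.symm {n : ℕ} {C D : ResolutionConfiguration n} (h : IsDualPair C D) :
    IsDualPair D C := by
  obtain ⟨β, h1, h2, h3, h4, h5, h6, h7⟩ := h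
  have key : ∀ (i : Fin n) (s t : Set ℝ),
      (fun q : ℝ × ℝ => β i q.swap) '' (s ×ˢ t) = β i '' (t ×ˢ s) := by
    intro i s t
    rw [← image_swap_prod, image_image]
    simp only [Prod.swap_swap]
  refine ⟨fun i q => β i q.swap, fun i => ⟨?_, ?_⟩, ?_, ?_, ?_, ?_, ?_, ?_⟩
  · exact (h1 i).1.comp continuous_swap.continuousOn fun q hq => ⟨hq.2, hq.1⟩
  · intro a ha b hb hab
    exact Prod.swap_injective ((h1 i).2 ⟨ha.2, ha.1⟩ ⟨hb.2, hb.1⟩ hab)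
  · intro i j hij
    simp only [square, key]
    exact h2 hij
  · intro i
    simp only [square, verticalSides, key]
    exact h4 i
  · intro i
    simp only [square, horizontalSides, key]
    exact h3 i
  · simp only [horizontalCore, key]
    exact h6
  · simp only [verticalCore, key]
    exact h5
  · simp only [square, key]
    exact h7.symm

theorem IsDualPair.mirror {n : ℕ} {C D : ResolutionConfiguration n} (h : IsDualPair C D) :
    IsDualPair C.mirror D.mirror := by
  obtain ⟨β, h1, h2, h3, h4, h5, h6, h7⟩ := h
  have key : ∀ (i : Fin n) (s : Set (ℝ × ℝ)),
      (fun q : ℝ × ℝ => mirrorPt (β i q)) '' s = mirrorPt '' (β i '' s) :=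
    fun i s => image_comp mirrorPt (β i) s
  have harcs : ∀ (T : Finset (Set S2)) (s : Set (ℝ × ℝ)),
      (T : Set (Set S2)) = range (fun i => β i '' s) →
      ((T.map ResolutionConfiguration.mirrorSet : Finset (Set S2)) : Set (Set S2)) =
        range (fun i => mirrorPt '' (β i '' s)) := by
    intro T s hT
    rw [Finset.coe_map, hT, ← range_comp]
    rfl
  refine ⟨fun i q => mirrorPt (β i q), fun i => ⟨?_, ?_⟩, ?_, ?_, ?_, ?_, ?_, ?_⟩
  · exact continuous_mirrorPt.comp_continuousOn (h1 i).1
  · intro a ha b hb hab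
    exact (h1 i).2 ha hb (mirrorPt_injective hab)
  · intro i j hij
    simp only [key]
    exact (disjoint_image_iff mirrorPt_injective).2 (h2 hij)
  · intro i
    rw [key, key, ResolutionConfiguration.circleUnion_mirror, ← image_inter mirrorPt_injective,
      h3 i]
  · intro i
    rw [key, key, ResolutionConfiguration.circleUnion_mirror, ← image_inter mirrorPt_injective,
      h4 i]
  · simp only [key]
    exact harcs _ _ h5
  · simp only [key]
    exact harcs _ _ h6
  · simp only [key, ResolutionConfiguration.circleUnion_mirror]
    rw [← image_iUnion, ← image_sdiff mirrorPt_injective, ← image_sdiff mirrorPt_injective, h7]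

/-- An `n`-dimensional resolution configuration `C = base` together with a geometric realisation
`ending` of its dual `C*` (which is determined by `C` only up to isotopy). The circles of `base`
are the starting circles and those of `ending` the ending circles of `C`. -/
structure ResolvedConfiguration (n : ℕ) where
  base : ResolutionConfiguration n
  ending : ResolutionConfiguration n
  isDualPair : IsDualPair base ending

namespace ResolvedConfiguration

variable {n : ℕ}

/-- The dual configuration; the dual of the dual is the original unoriented configuration. -/
def dual (R : ResolvedConfiguration n) : ResolvedConfiguration n :=
  ⟨R.ending, R.base, R.isDualPair.symm⟩

/-- The mirror image. -/
def mirror (R : ResolvedConfiguration n) : ResolvedConfiguration n :=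
  ⟨R.base.mirror, R.ending.mirror, R.isDualPair.mirror⟩

/-- A tree: a connected configuration of dimension `n` with exactly `n + 1` starting circles and
one ending circle. -/
def IsTree (R : ResolvedConfiguration n) : Prop :=
  R.base.Connected ∧ R.base.circles.card = n + 1 ∧ R.ending.circles.card = 1

/-- A dual tree: the dual of a tree. -/
def IsDualTree (R : ResolvedConfiguration n) : Prop :=
  ∃ T : ResolvedConfiguration n, T.IsTree ∧ R = T.dual

end ResolvedConfiguration

/-! ### The vector spaces and their monomials -/

/-- The algebra `𝔽₂[x]/(x²)`, with `x` written `DualNumber.eps`. -/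
abbrev CircleAlgebra : Type := DualNumber (ZMod 2)

/-- The tensor product of copies of `𝔽₂[x]/(x²)`, one for each circle in `ι`. -/
abbrev CircleSpace (ι : Type) : Type := ⨂[ZMod 2] _ : ι, CircleAlgebra

/-- The basis `1, x` of `𝔽₂[x]/(x²)`; the index `true` stands for `x`, `false` for `1`. -/
def circleBasis : Basis Bool (ZMod 2) CircleAlgebra :=
  Basis.ofEquivFun
    { toFun := fun v b => if b then v.snd else v.fst
      invFun := fun f => TrivSqZeroExt.inl (f false) + TrivSqZeroExt.inr (f true)
      map_add' := by intro v w; funext b; cases b <;> simp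
      map_smul' := by intro r v; funext b; cases b <;> simp
      left_inv := by intro v; ext <;> simp
      right_inv := by intro f; funext b; cases b <;> simp }

theorem circleBasis_false : circleBasis false = 1 := by
  ext <;> simp [circleBasis, Basis.ofEquivFun]

theorem circleBasis_true : circleBasis true = DualNumber.eps := by
  ext <;> simp [circleBasis, Basis.ofEquivFun]

/-- A monomial is recorded by the function telling which circles divide it. The monomials form a
basis of the tensor product: `monomialBasis a` is the tensor over the circles `i` of `x` (if
`a i = true`) or `1` (if `a i = false`). -/
def monomialBasis (ι : Type) [Finite ι] : Basis (ι → Bool) (ZMod 2) (CircleSpace ι) :=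
  Basis.piTensorProduct fun _ => circleBasis

/-- The coefficient of `v` at the monomial `b`. -/
def coeffAt {ι : Type} [Finite ι] (b : ι → Bool) (v : CircleSpace ι) : ZMod 2 :=
  (monomialBasis ι).repr v b

/-- The quantum degree of a monomial: each factor `x` counts `-1`, each factor `1` counts `1`. -/
def quantumDegree {ι : Type} [Fintype ι] (a : ι → Bool) : ℤ :=
  ∑ i, if a i then -1 else 1

namespace ResolvedConfiguration

variable {n : ℕ}

/-- `V₀(C)`. -/
abbrev V0 (R : ResolvedConfiguration n) : Type := CircleSpace R.base.circles

/-- `V₁(C)`. -/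
abbrev V1 (R : ResolvedConfiguration n) : Type := CircleSpace R.ending.circles

end ResolvedConfiguration

/-! ### Families of maps and the rules -/

/-- A map `F_C : V₀(C) → V₁(C)` for every `n`-dimensional unoriented configuration `C`. -/
abbrev MapFamily (n : ℕ) : Type :=
  ∀ R : ResolvedConfiguration n, R.V0 →ₗ[ZMod 2] R.V1

/-- The map `F : V₀(C) → V₁(C)` has bidegree `(n, p)`. The homological degree is `n` by
construction; the quantum degree of monomials of `V₁(C)` is shifted by the dimension `n`. -/
def HasBidegree {n : ℕ} {R : ResolvedConfiguration n} (F : R.V0 →ₗ[ZMod 2] R.V1) (p : ℤ) : Prop :=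
  ∀ (a : R.base.circles → Bool) (b : R.ending.circles → Bool),
    coeffAt b (F (monomialBasis _ a)) ≠ 0 → quantumDegree b + n - quantumDegree a = p

/-- The filtration rule: if the starting circle `x` and the ending circle `y` share a point, `a` is
divisible by `x`, and the coefficient of `F_C(a)` at `b` is non-zero, then `b` is divisible by
`y`. -/
def FiltrationRule {n : ℕ} (F : MapFamily n) : Prop :=
  ∀ (R : ResolvedConfiguration n) (a : R.base.circles → Bool) (b : R.ending.circles → Bool)
    (x : R.base.circles) (y : R.ending.circles),
    ((x : Set S2) ∩ (y : Set S2)).Nonempty → a x = true →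
    coeffAt b (F R (monomialBasis _ a)) ≠ 0 → b y = true

/-- The duality rule: the coefficient of `F_C(a)` at `b` is the coefficient of `F_{m(C*)}(b*)` at
`a*`. Here `a*` and `b*` arise by exchanging `1` and `x` in all factors, and are read as monomials
for `m(C*)`, whose starting circles are the mirrors of the ending circles of `C` and whose ending
circles are the mirrors of the starting circles of `C`. -/
def DualityRule {n : ℕ} (F : MapFamily n) : Prop :=
  ∀ (R : ResolvedConfiguration n) (a : R.base.circles → Bool) (b : R.ending.circles → Bool)
    (a' : R.dual.mirror.ending.circles → Bool) (b' : R.dual.mirror.base.circles → Bool),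
    (∀ x : R.base.circles, a' (R.base.mirrorCircle x) = !(a x)) →
    (∀ y : R.ending.circles, b' (R.ending.mirrorCircle y) = !(b y)) →
    coeffAt b (F R (monomialBasis _ a)) = coeffAt a' (F R.dual.mirror (monomialBasis _ b'))

/-- The naturality rule. Let `φ` be an orientation-preserving diffeomorphism of `S²` that sends the
circles and arcs of `C` to those of `C'`. It induces the bijection `e₀ : x ↦ φ(x)` of starting
circles, and the bijection `e₁` of ending circles such that whenever an ending circle `y` of `C`
runs along a segment of the starting circles (a connected component of the complement of the arcs
in the union of the starting circles), the ending circle `e₁ y` of `C'` runs along the image of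
that segment. Under these identifications, `F_C = F_{C'}`. -/
def NaturalityRule {n : ℕ} (F : MapFamily n) : Prop :=
  ∀ (R R' : ResolvedConfiguration n) (φ : Diffeomorph (𝓡 2) (𝓡 2) S2 S2 ∞),
    OrientationPreserving φ →
    (R'.base.circles : Set (Set S2)) = (fun s => φ '' s) '' (R.base.circles : Set (Set S2)) →
    (R'.base.arcs : Set (Set S2)) = (fun s => φ '' s) '' (R.base.arcs : Set (Set S2)) →
    ∀ (e₀ : R.base.circles ≃ R'.base.circles) (e₁ : R.ending.circles ≃ R'.ending.circles),
      (∀ x, (e₀ x : Set S2) = φ '' (x : Set S2)) →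
      (∀ (y : R.ending.circles), ∀ P ∈ (y : Set S2) ∩ R.base.circleUnion,
        ((e₁ y : Set S2) ∩
          φ '' connectedComponentIn (R.base.circleUnion \ R.base.arcUnion) P).Nonempty) →
      ∀ v : R.V0,
        F R' (PiTensorProduct.reindex (ZMod 2) (fun _ => CircleAlgebra) e₀ v) =
          PiTensorProduct.reindex (ZMod 2) (fun _ => CircleAlgebra) e₁ (F R v)

end

/-! ### Simple closed curves cut along disjoint arcs -/

/-! The proof compares quantum degrees with an Euler characteristic bound. Let `t` and `s` be the
numbers of starting and ending circles, and suppose that `F C` has a non-zero coefficient from a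
monomial `a`, divisible by `α` circles, to a monomial `b`, divisible by `β` circles. The assumption
on the bidegree says `s - t + 2α - 2β ≥ n`. On the other hand `s + t ≤ n + 2`
(`card_circles_add_card_circles_le`): the starting circles thickened and joined by bands form a
connected surface.

If all starting circles divide `a`, the filtration rule makes all ending circles divide `b`, because
each of them touches a starting circle. Then `t - s ≥ n`, and the bound forces `s = 1`, `t = n + 1`:
a tree. If `a = 1`, then `s - t ≥ n` forces `t = 1`, `s = n + 1`: a dual tree. Otherwise `α ≤ t -
1`, and the filtration rule gives `β ≥ 1`, so `s + t ≥ n + 4`, which is impossible.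

The bound on `s + t` is proved without homology of surfaces. The `2n` vertical sides of the bands
cut the starting circles into `2n` pieces, each with two of the `4n` corners
(`exists_pieces_of_circle`, `exists_pieces`). Functions on pieces with values in `ZMod 2` that are
constant on starting circles, and those constant on ending circles, both lie in the kernel of the
incidence matrix of bands and pieces. Connectedness bounds both the corank of this matrix and the
intersection of the two spaces by one, and a dimension count gives the bound (`card_add_card_le`).
-/

/-- The sign of a boolean: `1` for `true` and `-1` for `false`. -/
noncomputable def boolSign (o : Bool) : ℝ := if o then 1 else -1

theorem boolSign_mem (o : Bool) : boolSign o ∈ Icc (-1 : ℝ) 1 := by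
  cases o <;> simp [boolSign]

theorem image_Ioo_eq_sdiff {X : Type*} {f : ℝ → X} {a b : ℝ} (hab : a ≤ b)
    (hf : InjOn f (Icc a b)) : f '' Ioo a b = f '' Icc a b \ {f a, f b} := by
  ext p
  constructor
  · rintro ⟨u, hu, rfl⟩
    refine ⟨⟨u, Ioo_subset_Icc_self hu, rfl⟩, ?_⟩
    rintro (h | h)
    · exact hu.1.ne' (hf (Ioo_subset_Icc_self hu) (left_mem_Icc.2 hab) h)
    · exact hu.2.ne (hf (Ioo_subset_Icc_self hu) (right_mem_Icc.2 hab) h)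
  · rintro ⟨⟨u, hu, rfl⟩, h⟩
    refine ⟨u, ⟨lt_of_le_of_ne hu.1 ?_, lt_of_le_of_ne hu.2 ?_⟩, rfl⟩
    · rintro rfl
      exact h (Or.inl rfl)
    · rintro rfl
      exact h (Or.inr rfl)

theorem exists_Ico_of_periodic {X : Type*} {c : ℝ → X} (hper : Function.Periodic c 1) {p : X}
    (hp : p ∈ range c) : ∃ t ∈ Ico (0 : ℝ) 1, c t = p := by
  obtain ⟨t, rfl⟩ := hp
  obtain ⟨u, hu, h⟩ := hper.exists_mem_Ico₀ one_pos t
  exact ⟨u, hu, h.symm⟩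

/-- Parameters with the same image have the same fractional part, so they differ by an integer,
which lies strictly between `-1` and `1`. -/
theorem injOn_Ico_shift {X : Type*} {c : ℝ → X} (hper : Function.Periodic c 1)
    (hinj : InjOn c (Ico 0 1)) (τ : ℝ) : InjOn (fun t => c (t + τ)) (Ico 0 1) := by
  intro u hu v hv huv
  have key : ∀ w : ℝ, c w = c (Int.fract w) := fun w => by
    have := hper.sub_int_mul_eq (x := w) ⌊w⌋
    rw [mul_one] at this
    exact this.symm
  have huv' : c (u + τ) = c (v + τ) := huv
  rw [key, key (v + τ)] at huv'
  have h := hinj ⟨Int.fract_nonneg _, Int.fract_lt_one _⟩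
    ⟨Int.fract_nonneg _, Int.fract_lt_one _⟩ huv'
  obtain ⟨z, hz⟩ := Int.fract_eq_fract.1 h
  have h1 : ((-1 : ℤ) : ℝ) < z := by push_cast; linarith [hu.1, hv.2]
  have h2 : (z : ℝ) < ((1 : ℤ) : ℝ) := by push_cast; linarith [hu.2, hv.1]
  have h3 := Int.cast_lt.1 h1
  have h4 := Int.cast_lt.1 h2
  have : z = 0 := by omega
  rw [this] at hz
  push_cast at hz
  linarith

/-- A continuous function on the circle is not injective. -/
theorem not_injOn_of_periodic {f : ℝ → ℝ} (hf : Continuous f) (hper : Function.Periodic f 1)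
    (hinj : InjOn f (Ico 0 1)) : False := by
  have h01 : f 1 = f 0 := by simpa using hper 0
  -- Two overlapping intervals, each shorter than a period, together cover more than a period. On
  -- each of them `f` is strictly monotone, the overlap forces the same direction on both, and this
  -- contradicts `f 1 = f 0`.
  have hinj2 : InjOn f (Icc (1 / 2) (5 / 4)) := by
    intro u hu v hv huv
    have := injOn_Ico_shift hper hinj (1 / 2) 
      (show u - 1 / 2 ∈ Ico (0 : ℝ) 1 from ⟨by linarith [hu.1], by linarith [hu.2]⟩)
      (show v - 1 / 2 ∈ Ico (0 : ℝ) 1 from ⟨by linarith [hv.1], by linarith [hv.2]⟩)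
      (by simpa using huv)
    linarith
  have hinj1 : InjOn f (Icc 0 (3 / 4)) :=
    by
    refine hinj.mono fun u hu => ?_
    exact ⟨hu.1, by linarith [hu.2]⟩
  have m : ∀ {u : ℝ}, 0 ≤ u → u ≤ 3 / 4 → u ∈ Icc (0 : ℝ) (3 / 4) := fun h h' => ⟨h, h'⟩
  have m' : ∀ {u : ℝ}, 1 / 2 ≤ u → u ≤ 5 / 4 → u ∈ Icc (1 / 2 : ℝ) (5 / 4) := fun h h' => ⟨h, h'⟩
  rcases hf.continuousOn.strictMonoOn_of_injOn_Icc' (by norm_num) hinj1 with h1 | h1 <;>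
  rcases hf.continuousOn.strictMonoOn_of_injOn_Icc' (by norm_num) hinj2 with h2 | h2 <;>
  · have a1 := h1 (m (u := 0) (by norm_num) (by norm_num)) (m (u := 1 / 2) (by norm_num)
      (by norm_num)) (by norm_num)
    have a2 := h1 (m (u := 1 / 2) (by norm_num) (by norm_num)) (m (u := 3 / 4) (by norm_num)
      (by norm_num)) (by norm_num)
    have a3 := h2 (m' (u := 1 / 2) (by norm_num) (by norm_num)) (m' (u := 3 / 4) (by norm_num)
      (by norm_num)) (by norm_num)
    have a4 := h2 (m' (u := 3 / 4) (by norm_num) (by norm_num)) (m' (u := 1) (by norm_num)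
      (by norm_num)) (by norm_num)
    linarith

section Topology

variable {X : Type*} [TopologicalSpace X] [T2Space X]

/-- A left inverse of an injective path is continuous on the image of the path. -/
theorem exists_continuousOn_leftInverse {σ : ℝ → X} {a b : ℝ} (hσ : ContinuousOn σ (Icc a b))
    (hinj : InjOn σ (Icc a b)) :
    ∃ ρ : X → ℝ, ContinuousOn ρ (σ '' Icc a b) ∧ ∀ u ∈ Icc a b, ρ (σ u) = u := by
  have hl := hinj.leftInvOn_invFunOn
  refine ⟨Function.invFunOn σ (Icc a b), ?_, hl⟩
  -- Preimages of closed sets under the inverse are images of compact sets under `σ`.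
  rw [continuousOn_iff_isClosed]
  intro t ht
  refine ⟨σ '' (Icc a b ∩ t), ((isCompact_Icc.inter_right ht).image_of_continuousOn
    (hσ.mono inter_subset_left)).isClosed, ?_⟩
  ext p
  constructor
  · rintro ⟨h, u, hu, rfl⟩
    rw [mem_preimage, hl hu] at h
    exact ⟨⟨u, ⟨hu, h⟩, rfl⟩, u, hu, rfl⟩
  · rintro ⟨⟨u, ⟨hu, h⟩, rfl⟩, hp⟩
    refine ⟨?_, hp⟩
    rwa [mem_preimage, hl hu]

/-- An arc on a simple closed curve does not fill the curve. -/
theorem exists_notMem_arc {c : ℝ → X} (hc : Continuous c) (hper : Function.Periodic c 1)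
    (hinj : InjOn c (Ico 0 1)) {σ : ℝ → X} {a b : ℝ} (hσ : ContinuousOn σ (Icc a b))
    (hσi : InjOn σ (Icc a b)) : ∃ τ, c τ ∉ σ '' Icc a b := by
  -- If the arc filled the curve, `c` followed by the inverse of the arc would be a continuous
  -- injective real function on the circle.
  by_contra! h
  obtain ⟨ρ, hρ, hl⟩ := exists_continuousOn_leftInverse hσ hσi
  refine not_injOn_of_periodic (f := fun t => ρ (c t)) (hρ.comp_continuous hc h)
    (fun t => by simp only [hper t]) fun u hu v hv huv => hinj hu hv ?_
  obtain ⟨u', hu', h1⟩ := h u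
  obtain ⟨v', hv', h2⟩ := h v
  simp only [← h1, ← h2, hl _ hu', hl _ hv'] at huv
  rw [← h1, ← h2, huv]

/-- An arc on a simple closed curve that misses the base point is the image of an interval of
parameters. -/
theorem exists_Icc_of_arc {c : ℝ → X} (hc : Continuous c) (hper : Function.Periodic c 1)
    (hinj : InjOn c (Ico 0 1)) {σ : ℝ → X} (hσ : ContinuousOn σ (Icc (-1) 1))
    (hσi : InjOn σ (Icc (-1) 1)) (hσx : σ '' Icc (-1) 1 ⊆ range c)
    (h0 : c 0 ∉ σ '' Icc (-1) 1) :
    ∃ (a b : ℝ) (o : Bool), 0 < a ∧ a < b ∧ b < 1 ∧ c '' Icc a b = σ '' Icc (-1) 1 ∧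
      c '' Ioo a b = σ '' Ioo (-1) 1 ∧ σ (boolSign o) = c b ∧ σ (boolSign !o) = c a := by
  have hl := hinj.leftInvOn_invFunOn
  set ρ := Function.invFunOn c (Ico 0 1) with hρ
  have h1 : c 1 = c 0 := by simpa using hper 0
  have hr : ∀ p ∈ range c, ρ p ∈ Ico (0 : ℝ) 1 ∧ c (ρ p) = p := by
    intro p hp
    obtain ⟨t, ht, rfl⟩ := exists_Ico_of_periodic hper hp
    rw [hl ht]
    exact ⟨ht, rfl⟩
  have hcont : ContinuousOn ρ (σ '' Icc (-1) 1) := by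
    rw [continuousOn_iff_isClosed]
    intro T hT
    -- Compactness needs `Icc 0 1`, although `ρ` takes values in `Ico 0 1`; the extra parameter `1`
    -- gives the point `c 0`, which is not on the arc.
    refine ⟨c '' (Icc 0 1 ∩ T), ((isCompact_Icc.inter_right hT).image hc).isClosed, ?_⟩
    ext p
    constructor
    · rintro ⟨h, hp⟩
      have := hr p (hσx hp)
      exact ⟨⟨ρ p, ⟨Ico_subset_Icc_self this.1, h⟩, this.2⟩, hp⟩
    · rintro ⟨⟨u, ⟨hu, h⟩, rfl⟩, hp⟩
      refine ⟨?_, hp⟩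
      rcases eq_or_lt_of_le hu.2 with rfl | hu1
      · rw [h1] at hp
        exact absurd hp h0
      · rwa [mem_preimage, hl ⟨hu.1, hu1⟩]
  set r := fun u => ρ (σ u) with hrdef
  have hcr : ∀ u ∈ Icc (-1 : ℝ) 1, c (r u) = σ u := fun u hu => (hr _ (hσx ⟨u, hu, rfl⟩)).2
  have hrc : ContinuousOn r (Icc (-1) 1) := hcont.comp hσ (mapsTo_image _ _)
  have hri : InjOn r (Icc (-1) 1) := by
    intro u hu v hv huv
    refine hσi hu hv ?_
    rw [← hcr u hu, ← hcr v hv, huv]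
  have hr0 : ∀ u ∈ Icc (-1 : ℝ) 1, 0 < r u ∧ r u < 1 := by
    intro u hu
    have := (hr _ (hσx ⟨u, hu, rfl⟩)).1
    refine ⟨lt_of_le_of_ne this.1 fun h => h0 ⟨u, hu, ?_⟩, this.2⟩
    rw [← hcr u hu]
    exact congrArg c h.symm
  have hm : (-1 : ℝ) ∈ Icc (-1 : ℝ) 1 := by norm_num
  have hM : (1 : ℝ) ∈ Icc (-1 : ℝ) 1 := by norm_num
  have himage : c '' (r '' Icc (-1) 1) = σ '' Icc (-1) 1 := by
    rw [image_image]
    exact image_congr hcr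
  have fin : ∀ a b : ℝ, 0 < a → a < b → b < 1 → r '' Icc (-1) 1 = Icc a b →
      ({c a, c b} : Set X) = {σ (-1), σ 1} →
      c '' Icc a b = σ '' Icc (-1) 1 ∧ c '' Ioo a b = σ '' Ioo (-1) 1 := by
    intro a b ha hab hb h h'
    have e : c '' Icc a b = σ '' Icc (-1) 1 := by rw [← h, himage]
    refine ⟨e, ?_⟩
    rw [image_Ioo_eq_sdiff hab.le (hinj.mono ((Icc_subset_Icc_left ha.le).trans (Icc_subset_Ico_right hb))),
      image_Ioo_eq_sdiff (by norm_num) hσi, e, h']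
  -- The lift `r` of the arc is strictly monotone; `o` records whether `σ` runs with or against `c`.
  rcases hrc.strictMonoOn_of_injOn_Icc' (by norm_num) hri with h | h
  · have hab : r (-1) < r 1 := h hm hM (by norm_num)
    have := fin _ _ (hr0 _ hm).1 hab (hr0 _ hM).2 (Subset.antisymm
      (image_subset_iff.2 fun u hu => ⟨h.monotoneOn hm hu hu.1, h.monotoneOn hu hM hu.2⟩)
      (hrc.surjOn_Icc hm hM)) (by rw [hcr _ hm, hcr _ hM])
    exact ⟨_, _, true, (hr0 _ hm).1, hab, (hr0 _ hM).2, this.1, this.2,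
      by simp [boolSign, hcr _ hM], by simp [boolSign, hcr _ hm]⟩
  · have hab : r 1 < r (-1) := h hm hM (by norm_num)
    have := fin _ _ (hr0 _ hM).1 hab (hr0 _ hm).2 (Subset.antisymm
      (image_subset_iff.2 fun u hu => ⟨h.antitoneOn hu hM hu.2, h.antitoneOn hm hu hu.1⟩)
      (hrc.surjOn_Icc hM hm)) (by rw [hcr _ hm, hcr _ hM, pair_comm])
    exact ⟨_, _, false, (hr0 _ hM).1, hab, (hr0 _ hm).2, this.1, this.2,
      by simp [boolSign, hcr _ hm], by simp [boolSign, hcr _ hM]⟩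

end Topology

/-! ### The gaps between disjoint intervals -/

/-- The gaps between disjoint intervals `[a j, b j]`, `j ≠ j₀`, inside `[b j₀, a j₀]`: they are
`[b j, a (e j)]` for a permutation `e`. -/
theorem exists_gaps {J : Type*} [Finite J] (a b : J → ℝ) (j₀ : J)
    (h1 : ∀ j, b j < a j₀) (h2 : ∀ j, j ≠ j₀ → a j < b j) (h3 : ∀ i, b j₀ < a i)
    (h4 : ∀ i j, i ≠ j₀ → b j < b i → b j < a i) (hb : Function.Injective b) :
    ∃ e : J → J, Function.Bijective e ∧ (∀ j, b j < a (e j)) ∧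
      (∀ i j, b i < b j → a (e i) < b j) ∧
      ∀ z, (∃ j, z ∈ Icc (b j) (a (e j))) ↔
        z ∈ Icc (b j₀) (a j₀) ∧ ∀ i, i ≠ j₀ → z ∉ Ioo (a i) (b i) := by
  -- The gap that begins at `b j` ends at the nearest `a i` to its right, and this `i` is `e j`.
  have hex : ∀ j, ∃ i, b j < a i ∧ ∀ i', b j < a i' → a i ≤ a i' := by
    intro j
    obtain ⟨i, hi, hmin⟩ := Set.exists_min_image {i | b j < a i} a (Set.toFinite _) ⟨j₀, h1 j⟩
    exact ⟨i, hi, hmin⟩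
  choose e he hmin using hex
  have hb0 : ∀ j, b j₀ ≤ b j := by
    intro j
    by_cases h : j = j₀
    · rw [h]
    · exact ((h3 j).trans (h2 j h)).le
  have hgap : ∀ i j, b i < b j → a (e i) < b j := by
    intro i j hij
    have hj : j ≠ j₀ := by
      rintro rfl
      exact absurd hij (not_lt.2 (hb0 i))
    exact (hmin i j (h4 j i hj hij)).trans_lt (h2 j hj)
  have hinj : Function.Injective e := by
    intro i j hij
    by_contra hne
    rcases lt_or_gt_of_ne (hb.ne hne) with h | h
    · have := hgap i j h
      have := he j
      rw [← hij] at this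
      linarith
    · have := hgap j i h
      have := he i
      rw [hij] at this
      linarith
  refine ⟨e, Finite.injective_iff_bijective.1 hinj, he, hgap, fun z => ⟨?_, ?_⟩⟩
  · rintro ⟨j, hz⟩
    refine ⟨⟨(hb0 j).trans hz.1, hz.2.trans (hmin j j₀ (h1 j))⟩, fun i hi hzi => ?_⟩
    have := hmin j i (h4 i j hi (hz.1.trans_lt hzi.2))
    linarith [hzi.1, hz.2]
  · rintro ⟨hz, hz'⟩
    -- The gap containing `z` is the one that begins at the last `b j` not beyond `z`.
    obtain ⟨j, hj, hmax⟩ := Set.exists_max_image {j | b j ≤ z} b (Set.toFinite _) ⟨j₀, hz.1⟩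
    refine ⟨j, hj, ?_⟩
    by_contra! hlt
    have hne : e j ≠ j₀ := by
      intro h
      rw [h] at hlt
      exact absurd hz.2 (not_le.2 hlt)
    have h5 : b (e j) ≤ z := by
      by_contra! h
      exact hz' _ hne ⟨hlt, h⟩
    have := hmax _ h5
    linarith [he j, h2 _ hne]

theorem bool_eq_or_eq_not (x y : Bool) : x = y ∨ x = !y := by
  cases x <;> cases y <;> simp

/-- Cutting a simple closed curve along `k ≥ 1` disjoint arcs leaves `k` pieces, each containing
exactly two endpoints of the arcs. -/
theorem exists_pieces_of_circle {X : Type*} [TopologicalSpace X] [T2Space X] {c : ℝ → X}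
    (hc : Continuous c) (hper : Function.Periodic c 1) (hinj : InjOn c (Ico 0 1))
    {J : Type*} [Finite J] [Nonempty J] (σ : J → ℝ → X)
    (hσ : ∀ j, ContinuousOn (σ j) (Icc (-1) 1)) (hσi : ∀ j, InjOn (σ j) (Icc (-1) 1))
    (hσx : ∀ j, σ j '' Icc (-1) 1 ⊆ range c)
    (hdis : Pairwise fun i j => Disjoint (σ i '' Icc (-1) 1) (σ j '' Icc (-1) 1)) :
    ∃ G : J → Set X, (∀ j, IsClosed (G j)) ∧ (∀ j, IsPreconnected (G j)) ∧
      (Pairwise fun i j => Disjoint (G i) (G j)) ∧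
      (⋃ j, G j) = range c \ ⋃ j, σ j '' Ioo (-1) 1 ∧
      ∀ j, {k : J × Bool | σ k.1 (boolSign k.2) ∈ G j}.ncard = 2 := by
  obtain ⟨j₀⟩ := ‹Nonempty J›
  obtain ⟨τ, hτ⟩ := exists_notMem_arc hc hper hinj (hσ j₀) (hσi j₀)
  -- Move the base point first off the arc `j₀`, then to one of its endpoints.
  have hrange : ∀ τ : ℝ, range (fun t => c (t + τ)) = range c := fun τ =>
    (add_right_surjective τ).range_comp c
  have hpers : ∀ τ : ℝ, Function.Periodic (fun t => c (t + τ)) 1 := fun τ t => by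
    simp only [add_right_comm t 1 τ, hper (t + τ)]
  obtain ⟨a₀, b₀, o₀, ha₀, hab₀, hb₀, hcc₀, hoo₀, hcb₀, hca₀⟩ := exists_Icc_of_arc
    (c := fun t => c (t + τ)) (by fun_prop) (hpers τ) (injOn_Ico_shift hper hinj τ) (hσ j₀)
    (hσi j₀) (by rw [hrange]; exact hσx j₀) (by simpa using hτ)
  obtain ⟨d, hd⟩ : ∃ d : ℝ → X, d = fun t => c (t + (b₀ + τ)) := ⟨_, rfl⟩
  have hdc : Continuous d := by rw [hd]; fun_prop
  have hdp : Function.Periodic d 1 := by rw [hd]; exact hpers _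
  have hdi : InjOn d (Ico 0 1) := by rw [hd]; exact injOn_Ico_shift hper hinj _
  have hdr : range d = range c := by rw [hd]; exact hrange _
  have hdc' : ∀ t, d t = c (t + b₀ - 1 + τ) := by
    intro t
    rw [hd, ← hper (t + b₀ - 1 + τ)]
    exact congrArg c (by ring)
  -- In the parametrisation `d` the arc `j₀` occupies `[L, 1]`, so all other arcs and all pieces
  -- have their parameters in `[0, L]`.
  set L := a₀ + 1 - b₀ with hL
  have hL0 : 0 < L := by linarith
  have hL1 : L < 1 := by linarith
  have hd0 : σ j₀ (boolSign o₀) = d 0 := by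
    rw [hcb₀, hd]
    simp
  have hdL : σ j₀ (boolSign !o₀) = d L := by
    rw [hca₀, hdc']
    exact congrArg c (by ring)
  have hoo : d '' Ioo L 1 = σ j₀ '' Ioo (-1) 1 := by
    rw [← hoo₀]
    ext p
    constructor
    · rintro ⟨z, hz, rfl⟩
      exact ⟨z + b₀ - 1, ⟨by linarith [hz.1], by linarith [hz.2]⟩, (hdc' z).symm⟩
    · rintro ⟨z, hz, rfl⟩
      refine ⟨z - b₀ + 1, ⟨by linarith [hz.1], by linarith [hz.2]⟩, ?_⟩
      rw [hdc']
      exact congrArg c (by ring)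
  have hmem : ∀ j o, σ j (boolSign o) ∈ σ j '' Icc (-1) 1 := fun j o =>
    mem_image_of_mem _ (boolSign_mem o)
  have hdisj : ∀ {i j : J} {p : X}, p ∈ σ i '' Icc (-1) 1 → p ∈ σ j '' Icc (-1) 1 → i = j := by
    intro i j p hi hj
    by_contra h
    exact disjoint_left.1 (hdis h) hi hj
  -- Every arc runs from `d (a j)` to `d (b j)` in the direction of the curve. For `j₀` the end
  -- parameter `1` is recorded as `0`, so `b j₀ = 0` and `a j₀ = L` appear in reverse order and
  -- bound the interval in which the gaps lie.
  have hdata : ∀ j, ∃ (a b : ℝ) (o : Bool), 0 < a ∧ a < 1 ∧ 0 ≤ b ∧ b < L ∧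
      σ j (boolSign o) = d b ∧ σ j (boolSign !o) = d a ∧ (j = j₀ → b = 0 ∧ a = L) ∧
      (j ≠ j₀ → a < b ∧ d '' Icc a b = σ j '' Icc (-1) 1 ∧
        d '' Ioo a b = σ j '' Ioo (-1) 1) := by
    intro j
    by_cases hj : j = j₀
    · subst hj
      exact ⟨L, 0, o₀, hL0, hL1, le_rfl, hL0, hd0, hdL, fun _ => ⟨rfl, rfl⟩,
        fun h => absurd rfl h⟩
    · obtain ⟨a, b, o, h1, h2, h3, h4, h5, h6, h7⟩ := exists_Icc_of_arc hdc hdp hdi (hσ j)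
        (hσi j) (by rw [hdr]; exact hσx j) (fun h => hj (hdisj h (by
          rw [← hd0]
          exact hmem _ _)))
      refine ⟨a, b, o, h1, h2.trans h3, (h1.trans h2).le, ?_, h6, h7, fun h => absurd h hj,
        fun _ => ⟨h2, h4, h5⟩⟩
      by_contra! hbL
      refine hj (hdisj (p := d b) ?_ ?_)
      · rw [← h4]
        exact mem_image_of_mem _ (right_mem_Icc.2 h2.le)
      · rw [← hcc₀]
        exact ⟨b + b₀ - 1, ⟨by linarith, by linarith⟩, (hdc' b).symm⟩
  choose a b o ha0 ha1 hb0 hbL hdb hda hj0 hj1 using hdata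
  have hb1 : ∀ j, b j < 1 := fun j => (hbL j).trans hL1
  have hmb : ∀ j, d (b j) ∈ σ j '' Icc (-1) 1 := fun j => by
    rw [← hdb]
    exact hmem _ _
  have hbinj : Function.Injective b := fun i j h => hdisj (hmb i) (by
    rw [h]
    exact hmb j)
  obtain ⟨hbj, haj⟩ := hj0 j₀ rfl
  obtain ⟨e, he, hlt, hgap, hcover⟩ := exists_gaps a b j₀ (fun j => by rw [haj]; exact hbL j)
    (fun j hj => (hj1 j hj).1) (fun i => by rw [hbj]; exact ha0 i)
    (fun i j hi hij => by
      by_contra! h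
      have : i = j := by
        refine hdisj (p := d (b j)) ?_ (hmb j)
        rw [← (hj1 i hi).2.1]
        exact mem_image_of_mem _ ⟨h, hij.le⟩
      rw [this] at hij
      exact lt_irrefl _ hij) hbinj
  have hico : ∀ j u, u ∈ Icc (b j) (a (e j)) → u ∈ Ico (0 : ℝ) 1 := fun j u hu =>
    ⟨(hb0 j).trans hu.1, hu.2.trans_lt (ha1 _)⟩
  have hGdis : Pairwise fun i j =>
      Disjoint (d '' Icc (b i) (a (e i))) (d '' Icc (b j) (a (e j))) := by
    have : ∀ i j, b i < b j →
        Disjoint (d '' Icc (b i) (a (e i))) (d '' Icc (b j) (a (e j))) := by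
      intro i j hij
      rw [disjoint_left]
      rintro _ ⟨u, hu, rfl⟩ ⟨v, hv, huv⟩
      have := hdi (hico _ _ hv) (hico _ _ hu) huv
      linarith [hgap i j hij, hu.2, hv.1]
    intro i j hij
    rcases lt_or_gt_of_ne (hbinj.ne hij) with h | h
    · exact this i j h
    · exact (this j i h).symm
  refine ⟨fun j => d '' Icc (b j) (a (e j)), fun j => (isCompact_Icc.image hdc).isClosed,
    fun j => isPreconnected_Icc.image _ hdc.continuousOn, hGdis, ?_, fun j => ?_⟩
  · have hopen : ∀ z ∈ Ico (0 : ℝ) 1, ∀ j, d z ∈ σ j '' Ioo (-1) 1 ↔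
        (j = j₀ ∧ z ∈ Ioo L 1) ∨ (j ≠ j₀ ∧ z ∈ Ioo (a j) (b j)) := by
      intro z hz j
      by_cases hj : j = j₀
      · subst hj
        rw [← hoo, hdi.mem_image_iff (fun u hu => ⟨hL0.le.trans hu.1.le, hu.2⟩) hz]
        simp
      · rw [← (hj1 j hj).2.2,
          hdi.mem_image_iff (fun u hu => ⟨(ha0 j).le.trans hu.1.le, hu.2.trans (hb1 j)⟩) hz]
        simp [hj]
    ext p
    rw [← hdr, mem_iUnion, mem_sdiff, mem_iUnion]
    constructor
    · rintro ⟨j, z, hz, rfl⟩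
      refine ⟨mem_range_self z, ?_⟩
      rintro ⟨i, hi⟩
      obtain ⟨h1, h2⟩ := (hcover z).1 ⟨j, hz⟩
      rcases (hopen z (hico j z hz) i).1 hi with ⟨-, h⟩ | ⟨h, h'⟩
      · rw [haj] at h1
        exact absurd h.1 (not_lt.2 h1.2)
      · exact h2 i h h'
    · rintro ⟨hp, hp'⟩
      obtain ⟨z, hz, rfl⟩ := exists_Ico_of_periodic hdp hp
      push Not at hp'
      have hz' : z ∈ Icc (b j₀) (a j₀) := by
        rw [hbj, haj]
        refine ⟨hz.1, ?_⟩
        by_contra! h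
        exact hp' j₀ ((hopen z hz j₀).2 (Or.inl ⟨rfl, h, hz.2⟩))
      obtain ⟨j, hj⟩ := (hcover z).2 ⟨hz', fun i hi h =>
        hp' i ((hopen z hz i).2 (Or.inr ⟨hi, h⟩))⟩
      exact ⟨j, z, hj, rfl⟩
  -- A piece contains the end of the arc `j` that it follows and the start of the next arc `e j`.
  · have hset : {k : J × Bool | σ k.1 (boolSign k.2) ∈ d '' Icc (b j) (a (e j))} =
        {(j, o j), (e j, !o (e j))} := by
      ext ⟨i, δ⟩
      simp only [mem_ofPred_eq, mem_insert_iff, mem_singleton_iff, Prod.mk.injEq]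
      constructor
      · intro h
        rcases bool_eq_or_eq_not δ (o i) with rfl | rfl
        · left
          have : i = j := by
            by_contra hne
            refine disjoint_left.1 (hGdis hne) ?_ h
            rw [hdb]
            exact mem_image_of_mem _ (left_mem_Icc.2 (hlt i).le)
          rw [this]
          exact ⟨rfl, rfl⟩
        · right
          obtain ⟨j', rfl⟩ := he.2 i
          have : j' = j := by
            by_contra hne
            refine disjoint_left.1 (hGdis hne) ?_ h
            rw [hda]
            exact mem_image_of_mem _ (right_mem_Icc.2 (hlt j').le)
          rw [this]
          exact ⟨rfl, rfl⟩
      · rintro (⟨rfl, rfl⟩ | ⟨rfl, rfl⟩)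
        · rw [hdb]
          exact mem_image_of_mem _ (left_mem_Icc.2 (hlt i).le)
        · rw [hda]
          exact mem_image_of_mem _ (right_mem_Icc.2 (hlt j).le)
    -- With a single arc `e j = j`; the two labels still differ, in the boolean.
    rw [hset, ncard_pair]
    intro h
    have h1 : j = e j := congrArg Prod.fst h
    have h2 : o j = !o (e j) := congrArg Prod.snd h
    rw [← h1] at h2
    simp at h2

/-! ### The Euler characteristic bound, combinatorially -/

/-- Connectedness enters the dimension count through this bound, once for a kernel and once for an
intersection. -/
theorem finrank_le_one_of_const {F N : Type*} [Field F] [Fintype N] (W : Submodule F (N → F))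
    (h : ∀ f ∈ W, ∃ c, ∀ i, f i = c) : finrank F W ≤ 1 := by
  have hle : W ≤ Submodule.span F {fun _ => (1 : F)} := by
    intro f hf
    obtain ⟨c, hc⟩ := h f hf
    refine Submodule.mem_span_singleton.2 ⟨c, ?_⟩
    ext i
    simp [hc i]
  exact (Submodule.finrank_mono hle).trans ((finrank_span_le_card _).trans (by simp))

/-- A surface with boundary is glued from squares indexed by `N` along pieces of their boundary
indexed by `J`: the four corners of the squares are distributed by `q` to the pieces, two to each.
The vertical sides of the squares and the pieces form the circles in `A`, the horizontal sides and
the pieces form the circles in `B`. If the surface is connected, then the number of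
circles is bounded as for a sphere. -/
theorem card_add_card_le {N J A B : Type*} [Fintype N] [Fintype J] [Fintype A] [Fintype B]
    (q : N × Bool × Bool → J) (hq : ∀ j, {k | q k = j}.ncard = 2)
    (hJ : Fintype.card J = 2 * Fintype.card N) (u : J → A) (w : J → B)
    (hu : Function.Surjective u) (hw : Function.Surjective w)
    (huv : ∀ i ε δ δ', u (q (i, ε, δ)) = u (q (i, ε, δ')))
    (hwh : ∀ i ε ε' δ, w (q (i, ε, δ)) = w (q (i, ε', δ)))
    (hconst : ∀ f : N → ZMod 2, (∀ k k', q k = q k' → f k.1 = f k'.1) → ∃ c, ∀ i, f i = c) :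
    Fintype.card A + Fintype.card B ≤ Fintype.card N + 2 := by
  classical
  -- The entry at `(i, j)` counts modulo 2 the corners of the square `i` on the piece `j`.
  let M : Matrix N J (ZMod 2) := fun i j => ∑ e : Bool × Bool, if q (i, e) = j then 1 else 0
  have hM : ∀ φ i, M.mulVec φ i = ∑ e : Bool × Bool, φ (q (i, e)) := by
    intro φ i
    simp only [M, Matrix.mulVec, dotProduct, Finset.sum_mul]
    rw [Finset.sum_comm]
    simp
  have hMT : ∀ f j, M.transpose.mulVec f j =
      ∑ k : N × Bool × Bool, if q k = j then f k.1 else 0 := by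
    intro f j
    rw [Fintype.sum_prod_type]
    refine Finset.sum_congr rfl fun i _ => ?_
    change M i j * f i = _
    rw [Finset.sum_mul]
    simp only [ite_mul, one_mul, zero_mul]
  -- A piece has exactly two corners, so its equation in the kernel of the transpose says that `f`
  -- agrees on the squares of these corners.
  have hkerT : finrank (ZMod 2) (LinearMap.ker M.transpose.mulVecLin) ≤ 1 := by
    refine finrank_le_one_of_const _ fun f hf => hconst f fun k k' hkk => ?_
    by_cases hne : k = k'
    · rw [hne]
    have hset : {l | q l = q k} = {k, k'} := by
      symm
      refine Set.eq_of_subset_of_ncard_le ?_ (by rw [hq, ncard_pair hne]) (Set.toFinite _)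
      rintro l (rfl | rfl)
      · exact rfl
      · exact hkk.symm
    have h0 : M.transpose.mulVec f (q k) = 0 := congrFun (LinearMap.mem_ker.1 hf) (q k)
    rw [hMT, ← Finset.sum_filter] at h0
    have hfil : (Finset.univ.filter fun l => q l = q k) = {k, k'} := by
      ext l
      have := Set.ext_iff.1 hset l
      simpa using this
    rw [hfil, Finset.sum_pair hne] at h0
    exact CharTwo.add_eq_zero.1 h0
  have hrank : finrank (ZMod 2) (LinearMap.range M.mulVecLin) =
      finrank (ZMod 2) (LinearMap.range M.transpose.mulVecLin) := (Matrix.rank_transpose M).symm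
  have h1 := M.mulVecLin.finrank_range_add_finrank_ker
  have h2 := M.transpose.mulVecLin.finrank_range_add_finrank_ker
  rw [finrank_fintype_fun_eq_card] at h1 h2
  let WA := LinearMap.range (LinearMap.funLeft (ZMod 2) (ZMod 2) u)
  let WB := LinearMap.range (LinearMap.funLeft (ZMod 2) (ZMod 2) w)
  have hA : finrank (ZMod 2) WA = Fintype.card A := by
    rw [LinearMap.finrank_range_of_inj (LinearMap.funLeft_injective_of_surjective _ _ _ hu),
      finrank_fintype_fun_eq_card]
  have hB : finrank (ZMod 2) WB = Fintype.card B := by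
    rw [LinearMap.finrank_range_of_inj (LinearMap.funLeft_injective_of_surjective _ _ _ hw),
      finrank_fintype_fun_eq_card]
  have two : ∀ x : ZMod 2, x + x = 0 := CharTwo.add_self_eq_zero
  -- The four corners of a square cancel in pairs: along the vertical sides for `WA`, along the
  -- horizontal sides for `WB`.
  have hsup : WA ⊔ WB ≤ LinearMap.ker M.mulVecLin := by
    refine sup_le ?_ ?_
    · rintro _ ⟨φ, rfl⟩
      rw [LinearMap.mem_ker]
      ext i
      rw [Matrix.mulVecLin_apply, hM]
      simp only [LinearMap.funLeft_apply, Fintype.sum_prod_type, Fintype.sum_bool,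
        huv i _ true false, two, Pi.zero_apply]
    · rintro _ ⟨φ, rfl⟩
      rw [LinearMap.mem_ker]
      ext i
      rw [Matrix.mulVecLin_apply, hM]
      simp only [LinearMap.funLeft_apply, Fintype.sum_prod_type, Fintype.sum_bool,
        hwh i true false, two, Pi.zero_apply]
  have hqs : Function.Surjective q := by
    intro j
    obtain ⟨k, hk⟩ := Set.nonempty_of_ncard_ne_zero (s := {k | q k = j}) (by rw [hq]; norm_num)
    exact ⟨k, hk⟩
  -- A function in both spaces takes one value at all four corners of a square, so it descends to a
  -- function on squares, to which `hconst` applies.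
  have hinf : finrank (ZMod 2) (WA ⊓ WB : Submodule (ZMod 2) (J → ZMod 2)) ≤ 1 := by
    refine finrank_le_one_of_const _ ?_
    rintro f ⟨⟨φ, hφ⟩, ⟨ψ, hψ⟩⟩
    have e1 : ∀ j, f j = φ (u j) := fun j => by rw [← hφ]; rfl
    have e2 : ∀ j, f j = ψ (w j) := fun j => by rw [← hψ]; rfl
    have e3 : ∀ k : N × Bool × Bool, f (q k) = f (q (k.1, true, true)) := by
      rintro ⟨i, ε, δ⟩
      rw [e1, huv i ε δ true, ← e1, e2, hwh i ε true true, ← e2]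
    obtain ⟨c, hc⟩ := hconst (fun i => f (q (i, true, true))) fun k k' hkk => by
      rw [← e3, ← e3, hkk]
    refine ⟨c, fun j => ?_⟩
    obtain ⟨k, rfl⟩ := hqs j
    rw [e3, hc]
  -- With `r` the rank of `M`, the sum of the cardinalities of `A` and `B` is at most `(2|N| - r) +
  -- 1`, and `r ≥ |N| - 1`.
  have h3 := Submodule.finrank_sup_add_finrank_inf_eq WA WB
  have h4 := Submodule.finrank_mono hsup
  omega

/-! ### Embedded circles -/

theorem continuous_of_coe {c : ℝ → S2} (h : ContDiff ℝ ∞ fun t => (c t : E3)) : Continuous c :=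
  continuous_induced_rng.2 h.continuous

theorem IsEmbeddedCircle.isPreconnected {s : Set S2} (h : IsEmbeddedCircle s) :
    IsPreconnected s := by
  obtain ⟨c, h1, -, -, -, rfl⟩ := h
  exact isPreconnected_range (continuous_of_coe h1)

theorem IsEmbeddedCircle.isClosed {s : Set S2} (h : IsEmbeddedCircle s) : IsClosed s := by
  obtain ⟨c, h1, h2, -, -, rfl⟩ := h
  rw [← h2.image_Icc one_pos 0]
  exact (isCompact_Icc.image (continuous_of_coe h1)).isClosed

theorem IsEmbeddedCircle.nonempty {s : Set S2} (h : IsEmbeddedCircle s) : s.Nonempty := by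
  obtain ⟨c, -, -, -, -, rfl⟩ := h
  exact range_nonempty c

/-! ### Bands -/

/-- `β` is a family of bands realising `D` as a dual of `C`. -/
structure IsBandFamily {n : ℕ} (C D : ResolutionConfiguration n)
    (β : Fin n → ℝ × ℝ → S2) : Prop where
  continuousOn : ∀ i, ContinuousOn (β i) square
  injOn : ∀ i, InjOn (β i) square
  disjoint : Pairwise fun i j => Disjoint (β i '' square) (β j '' square)
  inter_base : ∀ i, β i '' square ∩ C.circleUnion = β i '' verticalSides
  inter_ending : ∀ i, β i '' square ∩ D.circleUnion = β i '' horizontalSides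
  arcs_base : (C.arcs : Set (Set S2)) = range (fun i => β i '' horizontalCore)
  arcs_ending : (D.arcs : Set (Set S2)) = range (fun i => β i '' verticalCore)
  sdiff_eq : C.circleUnion \ (⋃ i, β i '' square) = D.circleUnion \ (⋃ i, β i '' square)

theorem IsDualPair.exists_bandFamily {n : ℕ} {C D : ResolutionConfiguration n}
    (h : IsDualPair C D) : ∃ β, IsBandFamily C D β := by
  obtain ⟨β, h1, h2, h3, h4, h5, h6, h7⟩ := h
  exact ⟨β, fun i => (h1 i).1, fun i => (h1 i).2, h2, h3, h4, h5, h6, h7⟩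

theorem IsPreconnected.subset_or_subset_of_isClosed {X : Type*} [TopologicalSpace X]
    {s u v : Set X} (hs : IsPreconnected s) (hu : IsClosed u) (hv : IsClosed v)
    (huv : Disjoint u v) (h : s ⊆ u ∪ v) : s ⊆ u ∨ s ⊆ v :=
  isPreconnected_iff_subset_of_disjoint_closed.1 hs u v hu hv h
    (by rw [huv.inter_eq, inter_empty])

/-! ### Connected subsets of the circles, and arcs at each circle. -/

namespace ResolutionConfiguration

variable {n : ℕ} (C : ResolutionConfiguration n)

theorem mem_circleUnion {p : S2} : p ∈ C.circleUnion ↔ ∃ x ∈ C.circles, p ∈ x := by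
  simp [circleUnion]

variable {C}

theorem eq_of_mem {x y : Set S2} {p : S2} (hx : x ∈ C.circles) (hy : y ∈ C.circles)
    (hpx : p ∈ x) (hpy : p ∈ y) : x = y := by
  by_contra h
  exact disjoint_left.1 (C.circles_disjoint hx hy h) hpx hpy

/-- A preconnected subset of the circles lies on a single circle. -/
theorem subset_of_isPreconnected {s x : Set S2} {p : S2} (hs : IsPreconnected s)
    (h : s ⊆ C.circleUnion) (hp : p ∈ s) (hx : x ∈ C.circles) (hpx : p ∈ x) : s ⊆ x := by
  have hcl : IsClosed (⋃ y ∈ C.circles \ {x}, y) :=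
    (C.circles \ {x}).finite_toSet.isClosed_biUnion fun y hy =>
      (C.isEmbeddedCircle y (Finset.mem_sdiff.1 hy).1).isClosed
  have hd : Disjoint x (⋃ y ∈ C.circles \ {x}, y) := by
    rw [disjoint_left]
    intro r hr hr'
    simp only [mem_iUnion, Finset.mem_sdiff, Finset.mem_singleton] at hr'
    obtain ⟨y, ⟨hy, hne⟩, hry⟩ := hr'
    exact hne (eq_of_mem hy hx hry hr)
  have hcover : s ⊆ x ∪ ⋃ y ∈ C.circles \ {x}, y := by
    intro r hr
    obtain ⟨y, hy, hry⟩ := C.mem_circleUnion.1 (h hr)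
    by_cases hyx : y = x
    · exact Or.inl (hyx ▸ hry)
    · right
      simp only [mem_iUnion, Finset.mem_sdiff, Finset.mem_singleton]
      exact ⟨y, ⟨hy, hyx⟩, hry⟩
  rcases hs.subset_or_subset_of_isClosed (C.isEmbeddedCircle x hx).isClosed hcl hd hcover
    with h1 | h1
  · exact h1
  · exact absurd (h1 hp) (disjoint_left.1 hd hpx)

/-- In a connected configuration with at least one arc, every circle meets an arc. -/
theorem Connected.exists_arc (hC : C.Connected) (hn : C.arcs.Nonempty) {x : Set S2}
    (hx : x ∈ C.circles) : ∃ γ ∈ C.arcs, (γ ∩ x).Nonempty := by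
  by_cases h : ∃ x' ∈ C.circles, x' ∉ ({x} : Set (Set S2))
  · obtain ⟨γ, hγ, y, -, -, -, hy, -, h1, -⟩ := hC.2 {x} ⟨x, hx, rfl⟩ h
    rw [mem_singleton_iff.1 hy] at h1
    exact ⟨γ, hγ, h1⟩
  · push Not at h
    obtain ⟨γ, hγ⟩ := hn
    obtain ⟨g, -, h1, h2, -⟩ := C.isArc γ hγ
    obtain ⟨y, hy, hgy⟩ := C.mem_circleUnion.1 h2
    rw [mem_singleton_iff.1 (h y hy)] at hgy
    exact ⟨γ, hγ, g 0, h1 ▸ mem_image_of_mem g (by simp), hgy⟩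

end ResolutionConfiguration

/-! ### Sides and corners of bands; connectedness of the dual. -/

namespace IsBandFamily

open ResolutionConfiguration

variable {n : ℕ} {C D : ResolutionConfiguration n} {β : Fin n → ℝ × ℝ → S2}

/-- A corner of a band. -/
noncomputable def corner (β : Fin n → ℝ × ℝ → S2) (k : Fin n × Bool × Bool) : S2 :=
  β k.1 (boolSign k.2.1, boolSign k.2.2)

theorem boolSign_mem_pair (o : Bool) : boolSign o ∈ ({-1, 1} : Set ℝ) := by
  cases o <;> simp [boolSign]

theorem eq_boolSign {t : ℝ} (h : t ∈ ({-1, 1} : Set ℝ)) : ∃ o, t = boolSign o := by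
  rcases h with rfl | rfl
  · exact ⟨false, by simp [boolSign]⟩
  · exact ⟨true, by simp [boolSign]⟩

theorem mem_square (ε δ : Bool) : (boolSign ε, boolSign δ) ∈ square :=
  ⟨boolSign_mem ε, boolSign_mem δ⟩

theorem mem_vertical (ε : Bool) {t : ℝ} (ht : t ∈ Icc (-1 : ℝ) 1) :
    (boolSign ε, t) ∈ verticalSides := ⟨boolSign_mem_pair ε, ht⟩

theorem mem_horizontal (δ : Bool) {t : ℝ} (ht : t ∈ Icc (-1 : ℝ) 1) :
    (t, boolSign δ) ∈ horizontalSides := ⟨ht, boolSign_mem_pair δ⟩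

/-- The union of the starting circles and the bands. -/
def total (C : ResolutionConfiguration n) (β : Fin n → ℝ × ℝ → S2) : Set S2 :=
  C.circleUnion ∪ ⋃ i, β i '' square

theorem isClosed_band (h : IsBandFamily C D β) (i : Fin n) : IsClosed (β i '' square) :=
  ((isCompact_Icc.prod isCompact_Icc).image_of_continuousOn (h.continuousOn i)).isClosed

theorem isPreconnected_band (h : IsBandFamily C D β) (i : Fin n) :
    IsPreconnected (β i '' square) :=
  (isPreconnected_Icc.prod isPreconnected_Icc).image _ (h.continuousOn i)

theorem band_eq (h : IsBandFamily C D β) {i j : Fin n} {p : S2} (hi : p ∈ β i '' square)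
    (hj : p ∈ β j '' square) : i = j := by
  by_contra hne
  exact disjoint_left.1 (h.disjoint hne) hi hj

theorem continuousOn_vertical (h : IsBandFamily C D β) (i : Fin n) (ε : Bool) :
    ContinuousOn (fun t => β i (boolSign ε, t)) (Icc (-1) 1) :=
  (h.continuousOn i).comp (by fun_prop) fun _ ht => ⟨boolSign_mem ε, ht⟩

theorem continuousOn_horizontal (h : IsBandFamily C D β) (i : Fin n) (δ : Bool) :
    ContinuousOn (fun t => β i (t, boolSign δ)) (Icc (-1) 1) :=
  (h.continuousOn i).comp (by fun_prop) fun _ ht => ⟨ht, boolSign_mem δ⟩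

theorem injOn_vertical (h : IsBandFamily C D β) (i : Fin n) (ε : Bool) :
    InjOn (fun t => β i (boolSign ε, t)) (Icc (-1) 1) := fun _ hs _ ht hst =>
  congrArg Prod.snd (h.injOn i ⟨boolSign_mem ε, hs⟩ ⟨boolSign_mem ε, ht⟩ hst)

theorem vertical_mem (h : IsBandFamily C D β) (i : Fin n) (ε : Bool) {t : ℝ}
    (ht : t ∈ Icc (-1 : ℝ) 1) : β i (boolSign ε, t) ∈ C.circleUnion :=
  ((h.inter_base i).symm.subset (mem_image_of_mem _ (mem_vertical ε ht))).2

theorem horizontal_mem (h : IsBandFamily C D β) (i : Fin n) (δ : Bool) {t : ℝ}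
    (ht : t ∈ Icc (-1 : ℝ) 1) : β i (t, boolSign δ) ∈ D.circleUnion :=
  ((h.inter_ending i).symm.subset (mem_image_of_mem _ (mem_horizontal δ ht))).2

/-- A circle of `C` that meets a vertical side contains it. -/
theorem vertical_mem_of_mem (h : IsBandFamily C D β) {i : Fin n} {ε : Bool} {s t : ℝ} {x : Set S2}
    (hx : x ∈ C.circles) (hs : s ∈ Icc (-1 : ℝ) 1) (ht : t ∈ Icc (-1 : ℝ) 1)
    (hsx : β i (boolSign ε, s) ∈ x) : β i (boolSign ε, t) ∈ x := by
  refine subset_of_isPreconnected (isPreconnected_Icc.image _ (h.continuousOn_vertical i ε)) ?_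
    ⟨s, hs, rfl⟩ hx hsx ⟨t, ht, rfl⟩
  rintro _ ⟨u, hu, rfl⟩
  exact h.vertical_mem i ε hu

/-- A circle of `D` that meets a horizontal side contains it. -/
theorem horizontal_mem_of_mem (h : IsBandFamily C D β) {i : Fin n} {δ : Bool} {s t : ℝ}
    {y : Set S2} (hy : y ∈ D.circles) (hs : s ∈ Icc (-1 : ℝ) 1) (ht : t ∈ Icc (-1 : ℝ) 1)
    (hsy : β i (s, boolSign δ) ∈ y) : β i (t, boolSign δ) ∈ y := by
  refine subset_of_isPreconnected (isPreconnected_Icc.image _ (h.continuousOn_horizontal i δ)) ?_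
    ⟨s, hs, rfl⟩ hy hsy ⟨t, ht, rfl⟩
  rintro _ ⟨u, hu, rfl⟩
  exact h.horizontal_mem i δ hu

theorem exists_vertical (h : IsBandFamily C D β) {i : Fin n} {p : S2} (hp : p ∈ β i '' square)
    (hpC : p ∈ C.circleUnion) : ∃ ε, ∃ t ∈ Icc (-1 : ℝ) 1, p = β i (boolSign ε, t) := by
  obtain ⟨⟨s, t⟩, ⟨hs, ht⟩, rfl⟩ := (h.inter_base i).subset ⟨hp, hpC⟩
  obtain ⟨ε, rfl⟩ := eq_boolSign hs
  exact ⟨ε, t, ht, rfl⟩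

theorem exists_horizontal (h : IsBandFamily C D β) {i : Fin n} {p : S2} (hp : p ∈ β i '' square)
    (hpD : p ∈ D.circleUnion) : ∃ δ, ∃ t ∈ Icc (-1 : ℝ) 1, p = β i (t, boolSign δ) := by
  obtain ⟨⟨t, s⟩, ⟨ht, hs⟩, rfl⟩ := (h.inter_ending i).subset ⟨hp, hpD⟩
  obtain ⟨δ, rfl⟩ := eq_boolSign hs
  exact ⟨δ, t, ht, rfl⟩

theorem corner_mem_base (h : IsBandFamily C D β) (k : Fin n × Bool × Bool) :
    corner β k ∈ C.circleUnion := h.vertical_mem _ _ (boolSign_mem _)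

theorem corner_mem_ending (h : IsBandFamily C D β) (k : Fin n × Bool × Bool) :
    corner β k ∈ D.circleUnion := h.horizontal_mem _ _ (boolSign_mem _)

theorem corner_mem_band (k : Fin n × Bool × Bool) : corner β k ∈ β k.1 '' square :=
  mem_image_of_mem _ (mem_square _ _)

/-- Every circle shares a point with some circle of the dual configuration. -/
theorem exists_inter_nonempty (h : IsBandFamily C D β) {x : Set S2} (hx : x ∈ C.circles) :
    ∃ y ∈ D.circles, (x ∩ y).Nonempty := by
  suffices ∃ p ∈ x, p ∈ D.circleUnion by
    obtain ⟨p, hp, hpD⟩ := this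
    obtain ⟨y, hy, hpy⟩ := D.mem_circleUnion.1 hpD
    exact ⟨y, hy, p, hp, hpy⟩
  obtain ⟨p, hp⟩ := (C.isEmbeddedCircle x hx).nonempty
  have hpC : p ∈ C.circleUnion := C.mem_circleUnion.2 ⟨x, hx, hp⟩
  -- Off the bands the two configurations have the same circles; inside a band, the circle contains
  -- a whole vertical side, whose corners lie on both.
  by_cases hb : p ∈ ⋃ i, β i '' square
  · obtain ⟨i, hi⟩ := mem_iUnion.1 hb
    obtain ⟨ε, t, ht, rfl⟩ := h.exists_vertical hi hpC
    exact ⟨_, h.vertical_mem_of_mem hx ht (boolSign_mem true) hp, h.corner_mem_ending (i, ε, true)⟩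
  · exact ⟨p, hp, (h.sdiff_eq.subset ⟨hpC, hb⟩).1⟩

theorem circleUnion_ending_subset (h : IsBandFamily C D β) : D.circleUnion ⊆ total C β := by
  intro p hp
  by_cases hb : p ∈ ⋃ i, β i '' square
  · exact Or.inr hb
  · exact Or.inl (h.sdiff_eq.symm.subset ⟨hp, hb⟩).1

theorem band_subset_total (i : Fin n) : β i '' square ⊆ total C β :=
  (subset_iUnion (fun i => β i '' square) i).trans subset_union_right

/-- The union of the circles and the bands of a connected configuration is connected. -/
theorem isPreconnected_total (h : IsBandFamily C D β) (hC : C.Connected) :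
    IsPreconnected (total C β) := by
  rw [isPreconnected_iff_subset_of_disjoint_closed]
  intro u v hu hv huv hd
  have hcirc : ∀ x ∈ C.circles, x ⊆ total C β := fun x hx p hp =>
    Or.inl (C.mem_circleUnion.2 ⟨x, hx, hp⟩)
  have hside : ∀ s, IsPreconnected s → s ⊆ total C β → s ⊆ u ∨ s ⊆ v := by
    intro s hs hsX
    refine isPreconnected_iff_subset_of_disjoint_closed.1 hs u v hu hv (hsX.trans huv) ?_
    exact subset_eq_empty (inter_subset_inter_left _ hsX) hd
  have hcontra : ∀ p ∈ total C β, p ∈ u → p ∈ v → False := fun p hp h1 h2 =>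
    (hd.subset ⟨hp, h1, h2⟩ : p ∈ (∅ : Set S2))
  have hband : ∀ i, β i '' square ⊆ u ∨ β i '' square ⊆ v := fun i =>
    hside _ (h.isPreconnected_band i) (band_subset_total i)
  have hcircle : ∀ x ∈ C.circles, x ⊆ u ∨ x ⊆ v := fun x hx =>
    hside _ (C.isEmbeddedCircle x hx).isPreconnected (hcirc x hx)
  -- Each circle and each band lies in one of the two closed sets. If circles lay in both, some arc
  -- would join the two kinds, and the band around it could lie in neither.
  have hall : (∀ x ∈ C.circles, x ⊆ u) ∨ ∀ x ∈ C.circles, x ⊆ v := by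
    by_contra! hne
    obtain ⟨⟨x', hx', hx'u⟩, x, hx, hxv⟩ := hne
    obtain ⟨γ, hγ, y, hy, y', hy', hyu, hy'u, ⟨p, hpγ, hp⟩, ⟨p', hp'γ, hp'⟩⟩ :=
      hC.2 {x | x ⊆ u} ⟨x, hx, (hcircle x hx).resolve_right hxv⟩ ⟨x', hx', hx'u⟩
    obtain ⟨i, rfl⟩ := h.arcs_base.subset hγ
    have hcore : β i '' horizontalCore ⊆ β i '' square :=
      image_mono (prod_mono le_rfl (by simp))
    rcases hband i with hb | hb
    · exact hcontra p' (hcirc y' hy' hp') (hb (hcore hp'γ))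
        ((hcircle y' hy').resolve_left hy'u hp')
    · exact hcontra p (hcirc y hy hp) (hyu hp) (hb (hcore hpγ))
  have hcorner : ∀ i, ∃ p ∈ β i '' square, ∃ x ∈ C.circles, p ∈ x := fun i =>
    ⟨_, corner_mem_band (i, true, true), C.mem_circleUnion.1 (h.corner_mem_base _)⟩
  rcases hall with hall | hall
  · left
    rintro p (hp | hp)
    · obtain ⟨x, hx, hpx⟩ := C.mem_circleUnion.1 hp
      exact hall x hx hpx
    · obtain ⟨i, hi⟩ := mem_iUnion.1 hp
      obtain ⟨r, hr, x, hx, hrx⟩ := hcorner i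
      exact (hband i).resolve_right (fun hb => hcontra r (hcirc x hx hrx) (hall x hx hrx) (hb hr)) hi
  · right
    rintro p (hp | hp)
    · obtain ⟨x, hx, hpx⟩ := C.mem_circleUnion.1 hp
      exact hall x hx hpx
    · obtain ⟨i, hi⟩ := mem_iUnion.1 hp
      obtain ⟨r, hr, x, hx, hrx⟩ := hcorner i
      exact (hband i).resolve_left (fun hb => hcontra r (hcirc x hx hrx) (hb hr) (hall x hx hrx)) hi

/-- The dual of a connected configuration is connected. -/
theorem connected_ending (h : IsBandFamily C D β) (hC : C.Connected) : D.Connected := by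
  obtain ⟨x₀, hx₀⟩ := hC.1
  obtain ⟨y₀, hy₀, -⟩ := h.exists_inter_nonempty hx₀
  refine ⟨⟨y₀, hy₀⟩, fun S ⟨y₁, hy₁, hy₁S⟩ ⟨y₂, hy₂, hy₂S⟩ => ?_⟩
  by_contra! hno
  have hz : (0 : ℝ) ∈ Icc (-1 : ℝ) 1 := by norm_num
  -- `Y i δ` is the dual circle through the midpoint of the horizontal side `δ`, which is an
  -- endpoint of the dual arc. If no arc leaves `S`, the circles at both ends of a dual arc are both
  -- in `S` or both outside it.
  have hY : ∀ i δ, ∃ y ∈ D.circles, β i (0, boolSign δ) ∈ y := fun i δ =>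
    D.mem_circleUnion.1 (h.horizontal_mem i δ hz)
  choose Y hYD hYm using hY
  have hYS : ∀ i δ δ', Y i δ ∈ S → Y i δ' ∈ S := by
    intro i δ δ' h1
    by_contra h2
    have hγ : β i '' verticalCore ∈ D.arcs := h.arcs_ending.symm.subset ⟨i, rfl⟩
    have hm : ∀ δ, (β i '' verticalCore ∩ Y i δ).Nonempty := fun δ =>
      ⟨_, mem_image_of_mem _ (show ((0 : ℝ), boolSign δ) ∈ verticalCore from
        ⟨rfl, boolSign_mem δ⟩), hYm i δ⟩
    exact (hm δ').ne_empty (hno _ hγ _ (hYD i δ) _ (hYD i δ') h1 h2 (hm δ))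
  -- Each band is assigned to the class of the dual circles at its horizontal sides. Then `U S` and
  -- `U Sᶜ` are disjoint closed sets covering the connected set `total C β`, and both contain points
  -- of it.
  let U : Set (Set S2) → Set S2 := fun T =>
    (⋃ y ∈ {y | y ∈ D.circles ∧ y ∈ T}, y) ∪ ⋃ i ∈ {i | Y i true ∈ T}, β i '' square
  have hU : ∀ T p, p ∈ U T ↔ (∃ y ∈ D.circles, y ∈ T ∧ p ∈ y) ∨
      ∃ i, Y i true ∈ T ∧ p ∈ β i '' square := by
    intro T p
    simp only [U, mem_union, mem_iUnion, mem_ofPred_eq, exists_prop, and_assoc]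
  have hclosed : ∀ T, IsClosed (U T) := fun T =>
    ((D.circles.finite_toSet.subset fun y hy => hy.1).isClosed_biUnion fun y hy =>
      (D.isEmbeddedCircle y hy.1).isClosed).union
      ((Set.toFinite _).isClosed_biUnion fun i _ => h.isClosed_band i)
  have hcb : ∀ y ∈ D.circles, ∀ i p, p ∈ y → p ∈ β i '' square → ∃ δ, y = Y i δ := by
    intro y hy i p hpy hpi
    obtain ⟨δ, t, ht, rfl⟩ := h.exists_horizontal hpi (D.mem_circleUnion.2 ⟨y, hy, hpy⟩)
    exact ⟨δ, eq_of_mem hy (hYD i δ) (h.horizontal_mem_of_mem hy ht hz hpy) (hYm i δ)⟩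
  have hdisj : Disjoint (U S) (U Sᶜ) := by
    rw [disjoint_left]
    intro p hp hp'
    rcases (hU _ _).1 hp with ⟨y, hy, hyS, hpy⟩ | ⟨i, hi, hpi⟩ <;>
    rcases (hU _ _).1 hp' with ⟨y', hy', hyS', hpy'⟩ | ⟨i', hi', hpi'⟩
    · exact hyS' (eq_of_mem hy hy' hpy hpy' ▸ hyS)
    · obtain ⟨δ, rfl⟩ := hcb y hy i' p hpy hpi'
      exact hi' (hYS _ _ _ hyS)
    · obtain ⟨δ, rfl⟩ := hcb y' hy' i p hpy' hpi
      exact hyS' (hYS _ _ _ hi)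
    · exact hi' (h.band_eq hpi hpi' ▸ hi)
  have hcover : total C β ⊆ U S ∪ U Sᶜ := by
    have hbands : ∀ p ∈ ⋃ i, β i '' square, p ∈ U S ∪ U Sᶜ := by
      intro p hp
      obtain ⟨i, hi⟩ := mem_iUnion.1 hp
      by_cases hS : Y i true ∈ S
      · exact Or.inl ((hU _ _).2 (Or.inr ⟨i, hS, hi⟩))
      · exact Or.inr ((hU _ _).2 (Or.inr ⟨i, hS, hi⟩))
    rintro p (hp | hp)
    · by_cases hb : p ∈ ⋃ i, β i '' square
      · exact hbands p hb
      · obtain ⟨y, hy, hpy⟩ := D.mem_circleUnion.1 (h.sdiff_eq.subset ⟨hp, hb⟩).1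
        by_cases hS : y ∈ S
        · exact Or.inl ((hU _ _).2 (Or.inl ⟨y, hy, hS, hpy⟩))
        · exact Or.inr ((hU _ _).2 (Or.inl ⟨y, hy, hS, hpy⟩))
    · exact hbands p hp
  have hpt : ∀ y ∈ D.circles, ∃ p ∈ y, p ∈ total C β := by
    intro y hy
    obtain ⟨p, hp⟩ := (D.isEmbeddedCircle y hy).nonempty
    exact ⟨p, hp, h.circleUnion_ending_subset (D.mem_circleUnion.2 ⟨y, hy, hp⟩)⟩
  rcases (h.isPreconnected_total hC).subset_or_subset_of_isClosed (hclosed S) (hclosed Sᶜ) hdisj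
    hcover with hsub | hsub
  · obtain ⟨p, hp, hpX⟩ := hpt y₂ hy₂
    exact disjoint_left.1 hdisj (hsub hpX) ((hU _ _).2 (Or.inl ⟨y₂, hy₂, hy₂S, hp⟩))
  · obtain ⟨p, hp, hpX⟩ := hpt y₁ hy₁
    exact disjoint_left.1 hdisj ((hU _ _).2 (Or.inl ⟨y₁, hy₁, hy₁S, hp⟩)) (hsub hpX)

/-! ### Cutting circles into pieces at the corners, and counting circles. -/

theorem arcs_nonempty (hn : 0 < n) (C : ResolutionConfiguration n) : C.arcs.Nonempty := by
  rw [← Finset.card_pos, C.card_arcs]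
  exact hn

/-- The circle meets an arc, hence a vertical side of the band around it, and so contains that whole
side. This ensures that every circle really gets cut and that every circle carries a piece. -/
theorem exists_corner_mem_base (h : IsBandFamily C D β) (hC : C.Connected) (hn : 0 < n)
    {x : Set S2} (hx : x ∈ C.circles) : ∃ k, corner β k ∈ x := by
  obtain ⟨γ, hγ, p, hpγ, hp⟩ := hC.exists_arc (arcs_nonempty hn C) hx
  obtain ⟨i, rfl⟩ := h.arcs_base.subset hγ
  obtain ⟨ε, t, ht, rfl⟩ := h.exists_vertical (image_mono (prod_mono le_rfl (by simp)) hpγ)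
    (C.mem_circleUnion.2 ⟨x, hx, hp⟩)
  exact ⟨(i, ε, true), h.vertical_mem_of_mem hx ht (boolSign_mem true) hp⟩

theorem exists_corner_mem_ending (h : IsBandFamily C D β) (hD : D.Connected) (hn : 0 < n)
    {y : Set S2} (hy : y ∈ D.circles) : ∃ k, corner β k ∈ y := by
  obtain ⟨γ, hγ, p, hpγ, hp⟩ := hD.exists_arc (arcs_nonempty hn D) hy
  obtain ⟨i, rfl⟩ := h.arcs_ending.subset hγ
  obtain ⟨δ, t, ht, rfl⟩ := h.exists_horizontal (image_mono (prod_mono (by simp) le_rfl) hpγ)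
    (D.mem_circleUnion.2 ⟨y, hy, hp⟩)
  exact ⟨(i, true, δ), h.horizontal_mem_of_mem hy ht (boolSign_mem true) hp⟩

/-- A vertical side of a band. -/
noncomputable def side (β : Fin n → ℝ × ℝ → S2) (j : Fin n × Bool) (t : ℝ) : S2 := β j.1 (boolSign j.2, t)

theorem side_disjoint (h : IsBandFamily C D β) :
    Pairwise fun i j : Fin n × Bool =>
      Disjoint (side β i '' Icc (-1) 1) (side β j '' Icc (-1) 1) := by
  rintro ⟨i, ε⟩ ⟨i', ε'⟩ hne
  rw [disjoint_left]
  rintro _ ⟨s, hs, rfl⟩ ⟨t, ht, hst⟩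
  have hs' : (boolSign ε, s) ∈ square := ⟨boolSign_mem ε, hs⟩
  have ht' : (boolSign ε', t) ∈ square := ⟨boolSign_mem ε', ht⟩
  have hst' : β i' (boolSign ε', t) = β i (boolSign ε, s) := hst
  obtain rfl : i' = i := h.band_eq ⟨_, ht', hst'⟩ ⟨_, hs', rfl⟩
  have := congrArg Prod.fst (h.injOn i' ht' hs' hst')
  cases ε <;> cases ε' <;> simp [boolSign] at this hne <;> norm_num at this

/-- The circles cut along the vertical sides of the bands fall into pieces, each containing exactly
two corners. -/
theorem exists_pieces (h : IsBandFamily C D β) (hC : C.Connected) (hn : 0 < n) :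
    ∃ G : Fin n × Bool → Set S2, (∀ j, IsClosed (G j)) ∧ (∀ j, IsPreconnected (G j)) ∧
      (Pairwise fun i j => Disjoint (G i) (G j)) ∧
      (⋃ j, G j) = C.circleUnion \ (⋃ j, side β j '' Ioo (-1) 1) ∧
      ∀ j, {k | corner β k ∈ G j}.ncard = 2 := by
  have hz : (0 : ℝ) ∈ Icc (-1 : ℝ) 1 := by norm_num
  have hsub : ∀ x ∈ C.circles, ∀ j s, s ∈ Icc (-1 : ℝ) 1 → side β j s ∈ x →
      side β j '' Icc (-1) 1 ⊆ x := by
    rintro x hx j s hs hsx _ ⟨t, ht, rfl⟩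
    exact h.vertical_mem_of_mem hx hs ht hsx
  have hcirc : ∀ x : C.circles, ∃ G : {j // side β j 0 ∈ (x : Set S2)} → Set S2,
      (∀ j, IsClosed (G j)) ∧ (∀ j, IsPreconnected (G j)) ∧
      (Pairwise fun i j => Disjoint (G i) (G j)) ∧
      (⋃ j, G j) = (x : Set S2) \ (⋃ j : {j // side β j 0 ∈ (x : Set S2)},
        side β j '' Ioo (-1) 1) ∧
      ∀ j, {k : {j // side β j 0 ∈ (x : Set S2)} × Bool |
        side β k.1 (boolSign k.2) ∈ G j}.ncard = 2 := by
    rintro ⟨x, hx⟩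
    obtain ⟨c, h1, h2, h3, -, rfl⟩ := C.isEmbeddedCircle x hx
    obtain ⟨⟨i, ε, δ⟩, hk⟩ := h.exists_corner_mem_base hC hn hx
    have : Nonempty {j // side β j 0 ∈ range c} :=
      ⟨⟨(i, ε), h.vertical_mem_of_mem hx (boolSign_mem δ) hz hk⟩⟩
    exact exists_pieces_of_circle (continuous_of_coe h1) h2 h3
      (fun j : {j // side β j 0 ∈ range c} => side β j)
      (fun j => h.continuousOn_vertical _ _) (fun j => h.injOn_vertical _ _)
      (fun j => hsub _ hx _ 0 hz j.2)
      (fun i j hij => h.side_disjoint (Subtype.coe_injective.ne hij))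
  choose Gx hcl hpc hdis hun hcard using hcirc
  have hx : ∀ j, ∃ x : C.circles, side β j 0 ∈ (x : Set S2) := by
    intro j
    obtain ⟨x, hx, hj⟩ := C.mem_circleUnion.1 (h.vertical_mem j.1 j.2 hz)
    exact ⟨⟨x, hx⟩, hj⟩
  choose cx hcx using hx
  -- The pieces of `x` are indexed by the sides on `x`. As a side lies on only one circle, the
  -- pieces of all circles together can be indexed by the sides.
  have hG : ∀ (x : C.circles) (j : {j // side β j 0 ∈ (x : Set S2)}), Gx (cx j) ⟨j, hcx j⟩ = Gx x j := by
    rintro x ⟨j, hj⟩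
    obtain rfl : x = cx j := Subtype.ext (eq_of_mem x.2 (cx j).2 hj (hcx j))
    rfl
  have hGsub : ∀ x j, Gx x j ⊆ (x : Set S2) := fun x j =>
    (subset_iUnion (Gx x) j).trans ((hun x).subset.trans sdiff_subset)
  refine ⟨fun j => Gx (cx j) ⟨j, hcx j⟩, fun j => hcl _ _, fun j => hpc _ _, ?_, ?_, fun j => ?_⟩
  · intro i j hij
    rw [disjoint_left]
    intro p hi hj
    have hxx : cx i = cx j :=
      Subtype.ext (eq_of_mem (cx i).2 (cx j).2 (hGsub _ _ hi) (hGsub _ _ hj))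
    have hi' : side β i 0 ∈ (cx j : Set S2) := hxx ▸ hcx i
    have := hG (cx j) ⟨i, hi'⟩
    change p ∈ Gx (cx i) ⟨i, hcx i⟩ at hi
    rw [this] at hi
    exact disjoint_left.1 (hdis (cx j) (fun e => hij (congrArg Subtype.val e))) hi hj
  · ext p
    constructor
    · intro hp
      obtain ⟨j, hj⟩ := mem_iUnion.1 hp
      have hpx := (hun (cx j)).subset (mem_iUnion.2 ⟨_, hj⟩)
      refine ⟨C.mem_circleUnion.2 ⟨_, (cx j).2, hpx.1⟩, fun hp' => ?_⟩
      obtain ⟨i, t, ht, hi⟩ := mem_iUnion.1 hp'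
      have hix : side β i 0 ∈ (cx j : Set S2) :=
        hsub _ (cx j).2 i t (Ioo_subset_Icc_self ht) (hi ▸ hpx.1) ⟨0, hz, rfl⟩
      exact hpx.2 (mem_iUnion.2 ⟨⟨i, hix⟩, t, ht, hi⟩)
    · rintro ⟨hp, hp'⟩
      obtain ⟨x, hx, hpx⟩ := C.mem_circleUnion.1 hp
      obtain ⟨j, hj⟩ := mem_iUnion.1 ((hun ⟨x, hx⟩).symm.subset ⟨hpx, fun hm => by
        obtain ⟨i, hi⟩ := mem_iUnion.1 hm
        exact hp' (mem_iUnion.2 ⟨i, hi⟩)⟩)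
      rw [← hG] at hj
      exact mem_iUnion.2 ⟨j, hj⟩
  · rw [← hcard (cx j) ⟨j, hcx j⟩]
    have hinj : Function.Injective fun k : {i // side β i 0 ∈ (cx j : Set S2)} × Bool =>
        (k.1.1.1, k.1.1.2, k.2) := by
      rintro ⟨⟨⟨i, ε⟩, _⟩, δ⟩ ⟨⟨⟨i', ε'⟩, _⟩, δ'⟩ he
      simp only [Prod.mk.injEq] at he
      obtain ⟨rfl, rfl, rfl⟩ := he
      rfl
    rw [← ncard_image_of_injective _ hinj]
    congr 1
    ext ⟨i, ε, δ⟩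
    constructor
    · intro hk
      exact ⟨(⟨(i, ε), hsub _ (cx j).2 (i, ε) _ (boolSign_mem δ) (hGsub _ _ hk) ⟨0, hz, rfl⟩⟩, δ),
        hk, rfl⟩
    · rintro ⟨⟨⟨⟨i', ε'⟩, hi⟩, δ'⟩, hk, he⟩
      simp only [Prod.mk.injEq] at he
      obtain ⟨rfl, rfl, rfl⟩ := he
      exact hk

/-- The bound on the numbers of circles given by the Euler characteristic. -/
theorem card_circles_add_card_circles_le (h : IsBandFamily C D β) (hC : C.Connected) :
    C.circles.card + D.circles.card ≤ n + 2 := by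
  have hD := h.connected_ending hC
  -- Without bands there are no pieces to count; a connected configuration without arcs is a single
  -- circle.
  rcases Nat.eq_zero_or_pos n with rfl | hn
  · have key : ∀ E : ResolutionConfiguration 0, E.Connected → E.circles.card ≤ 1 := by
      intro E hE
      rw [Finset.card_le_one]
      intro x hx y hy
      by_contra hne
      obtain ⟨γ, hγ, -⟩ := hE.2 {x} ⟨x, hx, rfl⟩ ⟨y, hy, fun e => hne (mem_singleton_iff.1 e).symm⟩
      rw [Finset.card_eq_zero.1 E.card_arcs] at hγ
      exact absurd hγ (Finset.notMem_empty γ)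
    have := key C hC
    have := key D hD
    omega
  obtain ⟨G, hcl, hpc, hdis, hun, hcard⟩ := h.exists_pieces hC hn
  have hGC : ∀ j, G j ⊆ C.circleUnion := fun j =>
    (subset_iUnion G j).trans (hun.subset.trans sdiff_subset)
  have hGuniq : ∀ {i j p}, p ∈ G i → p ∈ G j → i = j := by
    intro i j p hi hj
    by_contra hne
    exact disjoint_left.1 (hdis hne) hi hj
  -- A piece avoids the interiors of the vertical sides, so it meets the bands only in corners.
  -- Hence it also lies on the circles of `D`.
  have hGband : ∀ j i p, p ∈ G j → p ∈ β i '' square → ∃ k, k.1 = i ∧ p = corner β k := by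
    intro j i p hj hi
    obtain ⟨ε, t, ht, rfl⟩ := h.exists_vertical hi (hGC j hj)
    have hnot : t ∉ Ioo (-1 : ℝ) 1 := fun ht' =>
      (hun.subset (mem_iUnion.2 ⟨j, hj⟩)).2 (mem_iUnion.2 ⟨(i, ε), t, ht', rfl⟩)
    obtain ⟨δ, rfl⟩ : ∃ δ, t = boolSign δ := by
      apply eq_boolSign
      by_contra hne
      simp only [mem_insert_iff, mem_singleton_iff, not_or] at hne
      exact hnot ⟨lt_of_le_of_ne ht.1 (Ne.symm hne.1), lt_of_le_of_ne ht.2 hne.2⟩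
    exact ⟨(i, ε, δ), rfl, rfl⟩
  have hGD : ∀ j, G j ⊆ D.circleUnion := by
    intro j p hp
    by_cases hb : p ∈ ⋃ i, β i '' square
    · obtain ⟨i, hi⟩ := mem_iUnion.1 hb
      obtain ⟨k, -, rfl⟩ := hGband j i p hp hi
      exact h.corner_mem_ending k
    · exact (h.sdiff_eq.subset ⟨hGC j hp, hb⟩).1
  have hq : ∀ k, ∃ j, corner β k ∈ G j := by
    intro k
    refine mem_iUnion.1 (hun.symm.subset ⟨h.corner_mem_base k, fun hm => ?_⟩)
    obtain ⟨j, t, ht, he⟩ := mem_iUnion.1 hm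
    have ht' := Ioo_subset_Icc_self ht
    have hj : j = (k.1, k.2.1) := by
      by_contra hne
      exact disjoint_left.1 (h.side_disjoint hne) ⟨t, ht', rfl⟩
        (he ▸ ⟨_, boolSign_mem k.2.2, rfl⟩)
    subst hj
    have : t = boolSign k.2.2 := h.injOn_vertical _ _ ht' (boolSign_mem _) he
    rw [this] at ht
    cases hb : k.2.2 <;> simp [boolSign, hb] at ht
  choose q hq using hq
  have hqj : ∀ j, {k | q k = j} = {k | corner β k ∈ G j} := by
    intro j
    ext k
    exact ⟨fun e => e ▸ hq k, fun hk => hGuniq (hq k) hk⟩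
  have hqs : ∀ j, ∃ k, q k = j := fun j =>
    Set.nonempty_of_ncard_ne_zero (s := {k | q k = j}) (by rw [hqj, hcard]; norm_num)
  have hu : ∀ j, ∃ x : C.circles, G j ⊆ x := by
    intro j
    obtain ⟨k, rfl⟩ := hqs j
    obtain ⟨x, hx, hk⟩ := C.mem_circleUnion.1 (h.corner_mem_base k)
    exact ⟨⟨x, hx⟩, subset_of_isPreconnected (hpc _) (hGC _) (hq k) hx hk⟩
  have hw : ∀ j, ∃ y : D.circles, G j ⊆ y := by
    intro j
    obtain ⟨k, rfl⟩ := hqs j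
    obtain ⟨y, hy, hk⟩ := D.mem_circleUnion.1 (h.corner_mem_ending k)
    exact ⟨⟨y, hy⟩, subset_of_isPreconnected (hpc _) (hGD _) (hq k) hy hk⟩
  choose u hu using hu
  choose w hw using hw
  have hbound := card_add_card_le q (fun j => by rw [hqj]; exact hcard j)
    (by simp [mul_comm]) u w ?_ ?_ ?_ ?_ ?_
  · simpa using hbound
  · rintro ⟨x, hx⟩
    obtain ⟨k, hk⟩ := h.exists_corner_mem_base hC hn hx
    exact ⟨q k, Subtype.ext (eq_of_mem (u (q k)).2 hx (hu _ (hq k)) hk)⟩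
  · rintro ⟨y, hy⟩
    obtain ⟨k, hk⟩ := h.exists_corner_mem_ending hD hn hy
    exact ⟨q k, Subtype.ext (eq_of_mem (w (q k)).2 hy (hw _ (hq k)) hk)⟩
  · intro i ε δ δ'
    refine Subtype.ext (eq_of_mem (u _).2 (u _).2 ?_ (hu _ (hq (i, ε, δ'))))
    exact h.vertical_mem_of_mem (u _).2 (boolSign_mem δ) (boolSign_mem δ') (hu _ (hq (i, ε, δ)))
  · intro i ε ε' δ
    refine Subtype.ext (eq_of_mem (w _).2 (w _).2 ?_ (hw _ (hq (i, ε', δ))))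
    exact h.horizontal_mem_of_mem (w _).2 (boolSign_mem ε) (boolSign_mem ε') (hw _ (hq (i, ε, δ)))
  · intro f hf
    refine ⟨f ⟨0, hn⟩, fun i => ?_⟩
    by_contra hne
    -- A function on bands that agrees whenever two corners share a piece splits `total C β` into
    -- disjoint closed sets according to its values; by connectedness only one value occurs.
    let V : Set (ZMod 2) → Set S2 := fun T =>
      (⋃ i ∈ {i | f i ∈ T}, β i '' square) ∪ ⋃ j ∈ {j | ∃ k, q k = j ∧ f k.1 ∈ T}, G j
    have hV : ∀ T p, p ∈ V T ↔ (∃ i, f i ∈ T ∧ p ∈ β i '' square) ∨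
        ∃ k, f k.1 ∈ T ∧ p ∈ G (q k) := by
      intro T p
      simp only [V, mem_union, mem_iUnion, mem_ofPred_eq, exists_prop]
      refine or_congr Iff.rfl ⟨?_, ?_⟩
      · rintro ⟨_, ⟨k, rfl, hk⟩, hp⟩
        exact ⟨k, hk, hp⟩
      · rintro ⟨k, hk, hp⟩
        exact ⟨_, ⟨k, rfl, hk⟩, hp⟩
    have hclosed : ∀ T, IsClosed (V T) := fun T =>
      ((Set.toFinite _).isClosed_biUnion fun i _ => h.isClosed_band i).union
        ((Set.toFinite _).isClosed_biUnion fun j _ => hcl j)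
    have hbg : ∀ i k p, p ∈ β i '' square → p ∈ G (q k) → f i = f k.1 := by
      intro i k p hi hk
      obtain ⟨k', rfl, rfl⟩ := hGband _ i p hk hi
      exact hf _ _ (hGuniq (hq k') hk)
    have hdisj : ∀ T, Disjoint (V T) (V Tᶜ) := by
      intro T
      rw [disjoint_left]
      intro p hp hp'
      rcases (hV _ _).1 hp with ⟨i, hi, hpi⟩ | ⟨k, hk, hpk⟩ <;>
      rcases (hV _ _).1 hp' with ⟨i', hi', hpi'⟩ | ⟨k', hk', hpk'⟩
      · exact hi' (h.band_eq hpi hpi' ▸ hi)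
      · exact hk' (hbg _ _ _ hpi hpk' ▸ hi)
      · exact hi' ((hbg _ _ _ hpi' hpk).symm ▸ hk)
      · exact hk' (hf _ _ (hGuniq hpk hpk') ▸ hk)
    have hcover : ∀ T, total C β ⊆ V T ∪ V Tᶜ := by
      intro T
      have hbands : ∀ i, β i '' square ⊆ V T ∪ V Tᶜ := by
        intro i p hi
        by_cases hT : f i ∈ T
        · exact Or.inl ((hV _ _).2 (Or.inl ⟨i, hT, hi⟩))
        · exact Or.inr ((hV _ _).2 (Or.inl ⟨i, hT, hi⟩))
      rintro p (hp | hp)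
      · by_cases ho : p ∈ ⋃ j, side β j '' Ioo (-1) 1
        · obtain ⟨j, t, ht, rfl⟩ := mem_iUnion.1 ho
          exact hbands j.1 ⟨_, ⟨boolSign_mem j.2, Ioo_subset_Icc_self ht⟩, rfl⟩
        · obtain ⟨j, hj⟩ := mem_iUnion.1 (hun.symm.subset ⟨hp, ho⟩)
          obtain ⟨k, rfl⟩ := hqs j
          by_cases hT : f k.1 ∈ T
          · exact Or.inl ((hV _ _).2 (Or.inr ⟨k, hT, hj⟩))
          · exact Or.inr ((hV _ _).2 (Or.inr ⟨k, hT, hj⟩))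
      · obtain ⟨i, hi⟩ := mem_iUnion.1 hp
        exact hbands i hi
    have hm : ∀ i, corner β (i, true, true) ∈ β i '' square := fun i =>
      corner_mem_band (i, true, true)
    rcases (h.isPreconnected_total hC).subset_or_subset_of_isClosed (hclosed {f ⟨0, hn⟩})
      (hclosed _) (hdisj _) (hcover _) with hsub | hsub
    · exact disjoint_left.1 (hdisj _) (hsub (band_subset_total i (hm i)))
        ((hV _ _).2 (Or.inl ⟨i, hne, hm i⟩))
    · exact disjoint_left.1 (hdisj {f ⟨0, hn⟩}) ((hV _ _).2 (Or.inl ⟨⟨0, hn⟩, rfl, hm _⟩))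
        (hsub (band_subset_total ⟨0, hn⟩ (hm _)))

end IsBandFamily

/-! ### Quantum degrees -/

theorem quantumDegree_eq {ι : Type} [Fintype ι] (a : ι → Bool) :
    quantumDegree a = Fintype.card ι - 2 * (Finset.univ.filter fun i => a i = true).card := by
  have h : ∀ i, (if a i then (-1 : ℤ) else 1) = 1 - 2 * (if a i = true then 1 else 0) := by
    intro i
    cases a i <;> simp
  simp only [quantumDegree, h, Finset.sum_sub_distrib, ← Finset.mul_sum, Finset.sum_boole]
  simp

theorem linearMap_eq_zero_of_coeffAt {ι κ : Type} [Finite ι] [Finite κ]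
    (f : CircleSpace ι →ₗ[ZMod 2] CircleSpace κ)
    (h : ∀ a b, coeffAt b (f (monomialBasis ι a)) = 0) : f = 0 := by
  refine (monomialBasis ι).ext fun a => ?_
  apply (monomialBasis κ).repr.injective
  ext b
  simpa [coeffAt] using h a b

/-- The tree is `C.dual`, which is connected because `C` is; its dual is `C` by definition. -/
theorem ResolvedConfiguration.isDualTree_of_card {n : ℕ} {C : ResolvedConfiguration n}
    (hC : C.base.Connected) (h1 : C.base.circles.card = 1)
    (h2 : C.ending.circles.card = n + 1) : C.IsDualTree := by
  obtain ⟨β, hβ⟩ := C.isDualPair.exists_bandFamily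
  exact ⟨C.dual, ⟨hβ.connected_ending hC, h2, h1⟩, rfl⟩

theorem theorem3p4 (n : ℕ) (F : MapFamily n)
    (hfiltration : FiltrationRule F) (hduality : DualityRule F) (hnaturality : NaturalityRule F)
    (C : ResolvedConfiguration n) (hconn : C.base.Connected)
    (htree : ¬ C.IsTree) (hdualTree : ¬ C.IsDualTree)
    (p : ℤ) (hp : 2 * (n : ℤ) ≤ p) (hdeg : HasBidegree (F C) p) :
    F C = 0 := by
  refine linearMap_eq_zero_of_coeffAt _ fun a b => ?_
  by_contra hab
  have hq := hdeg a b hab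
  obtain ⟨β, hβ⟩ := C.isDualPair.exists_bandFamily
  obtain ⟨β', hβ'⟩ := C.isDualPair.symm.exists_bandFamily
  have heuler := hβ.card_circles_add_card_circles_le hconn
  have hbase : 0 < C.base.circles.card := Finset.card_pos.2 hconn.1
  have hending : 0 < C.ending.circles.card := Finset.card_pos.2 (hβ.connected_ending hconn).1
  rw [quantumDegree_eq, quantumDegree_eq, Fintype.card_coe, Fintype.card_coe] at hq
  by_cases hall : ∀ x, a x = true
  · have hb : ∀ y, b y = true := by
      rintro ⟨y, hy⟩
      obtain ⟨x, hx, hyx⟩ := hβ'.exists_inter_nonempty hy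
      exact hfiltration C a b ⟨x, hx⟩ ⟨y, hy⟩ (inter_comm y x ▸ hyx) (hall _) hab
    simp only [hall, hb, Finset.filter_true, Finset.card_univ, Fintype.card_coe] at hq
    -- Here `t - s ≥ n` and `s + t ≤ n + 2`, so `s ≤ 1`; positivity of `s` gives `s = 1` and `t = n
    -- + 1`.
    exact htree ⟨hconn, by omega, by omega⟩
  by_cases hnone : ∀ x, a x = false
  · simp only [hnone, Bool.false_eq_true, Finset.filter_false, Finset.card_empty] at hq
    -- Here `s - t ≥ n + 2β ≥ n`, so `t = 1` and `s = n + 1` in the same way.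
    exact hdualTree (ResolvedConfiguration.isDualTree_of_card hconn (by omega) (by omega))
  push Not at hall hnone
  obtain ⟨x₀, hx₀⟩ := hall
  obtain ⟨x₁, hx₁⟩ := hnone
  obtain ⟨y₁, hy₁, hxy⟩ := hβ.exists_inter_nonempty x₁.2
  have hb1 := hfiltration C a b x₁ ⟨y₁, hy₁⟩ hxy (by simpa using hx₁) hab
  have hbpos : 0 < (Finset.univ.filter fun y => b y = true).card :=
    Finset.card_pos.2 ⟨⟨y₁, hy₁⟩, by simpa using hb1⟩
  have halt : (Finset.univ.filter fun x => a x = true).card < C.base.circles.card := by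
    rw [← Fintype.card_coe C.base.circles, ← Finset.card_univ]
    refine Finset.card_lt_card (Finset.ssubset_univ_iff.2 fun he => hx₀ ?_)
    simpa using he.symm.subset (Finset.mem_univ x₀)
  -- From `α ≤ t - 1` and `β ≥ 1` the degree inequality gives `s + t ≥ n + 4`, against the bound `n
  -- + 2`.
  omega
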